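/- A \emph{continuum} is a nonempty compact connected metric space. An \emph{arc} is a space homeomorphic to $[0,1]$, and a \emph{simple closed curve} is a space homeomorphic to the unit circle. A \emph{dendrite} is a locally connected continuum that contains no simple closed curve. The \emph{order} of a point $x$ of a dendrite $X$ is the number of connected components of $X\setminus\{x\}$, and $x$ is a \emph{branching point} if its order is at least $3$. A \emph{finite tree} is a dendrite with only finitely many branching points, each of which has finite order. A map $f\colon X\to X$ on a metric space $(X,d)$ is \emph{equicontinuous} if for every $x\in X$ and every $\varepsilon>0$ there is $\delta>0$ such that $d(x,y)<\delta$ implies $d(f^n(x),f^n(y))\le\varepsilon$ for all $y\in X$ and all $n\ge 1$. \textbf{Theorem.} Let $X$ be a finite tree and let $f\colon X\to X$ be a continuous map. If $f$ is not equicontinuous, then $X$ contains an $f$-expanding arc, that is, there are an arc $A\subseteq X$ and an integer $n\ge 1$ such that $A\subsetneq f^n[A]$. -/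

import Mathlib

/-- A subset of a space is an arc if, as a subspace, it is homeomorphic to `[0,1]`. -/
def IsArc {X : Type*} [TopologicalSpace X] (A : Set X) : Prop :=
  Nonempty (A ≃ₜ unitInterval)

/-- A subset of a space is a simple closed curve if, as a subspace, it is homeomorphic to the
unit circle. -/
def IsSimpleClosedCurve {X : Type*} [TopologicalSpace X] (C : Set X) : Prop :=
  Nonempty (C ≃ₜ Circle)

/-- A dendrite: a locally connected continuum (compact connected metric space, nonempty) that
contains no simple closed curve. -/
structure IsDendrite (X : Type*) [MetricSpace X] : Prop where
  compactSpace : CompactSpace X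
  connectedSpace : ConnectedSpace X
  locallyConnectedSpace : LocallyConnectedSpace X
  not_isSimpleClosedCurve : ∀ C : Set X, ¬ IsSimpleClosedCurve C

/-- The order of a point `x`: the number (possibly infinite, `⊤`) of connected components of the
subspace `X \ {x}`. -/
noncomputable def pointOrder {X : Type*} [TopologicalSpace X] (x : X) : ℕ∞ :=
  ENat.card (ConnectedComponents ↥({x}ᶜ : Set X))

/-- A branching point is a point of order at least three. -/
def IsBranchingPoint {X : Type*} [TopologicalSpace X] (x : X) : Prop :=
  3 ≤ pointOrder x

/-- A finite tree: a dendrite with only finitely many branching points, each of finite order. -/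
structure IsFiniteTree (X : Type*) [MetricSpace X] : Prop extends IsDendrite X where
  finite_branchingPoints : {x : X | IsBranchingPoint x}.Finite
  pointOrder_lt_top : ∀ x : X, IsBranchingPoint x → pointOrder x < ⊤

/-- A self-map is equicontinuous if the family of its iterates is equicontinuous at every point.
(Whether the identity `f^[0]` is included in the family makes no difference.) -/
def IsEquicontinuousMap {X : Type*} [MetricSpace X] (f : X → X) : Prop :=
  Equicontinuous (fun n : ℕ => f^[n])

/-- `A` is an `f`-expanding arc: an arc properly contained in its image under some iterate of
`f`. -/
def IsExpandingArc {X : Type*} [MetricSpace X] (f : X → X) (A : Set X) : Prop :=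
  IsArc A ∧ ∃ n : ℕ, 1 ≤ n ∧ A ⊂ f^[n] '' A

/-!
The proof is by contraposition: a map `f` of a finite tree without expanding arcs is shown to be
equicontinuous.

*Segments.* A compact, locally connected metric space is locally path connected
(`locallyPathConnectedSpace_of_compactSpace`: chains of points are refined again and again and
converge to a path), and a path between distinct points contains an arc (`exists_injOn_path`). Two
arcs around a point would produce a simple closed curve, so in a dendrite every connected set
containing the ends of an arc contains the arc
(`IsDendrite.image_subset_of_isPreconnected`). Hence `seg a b`, the set of points that lie in every
connected set containing `a` and `b`, is the unique arc from `a` to `b`. After the choice of a root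
`p`, the relation `x ∈ seg p y` is a partial order; in a finite tree it is a finite union of chains
(`IsFiniteTree.exists_chain_labelling`).

*Dynamics.* Take for root a fixed point `p` of `f` (`IsDendrite.exists_fixedPoint`). As `f^[n]`
maps `seg p x` onto a connected set containing `p` and `f^[n] x`, the absence of expanding arcs
means that `f^[n] x` is never strictly beyond `x`. An infinite backward orbit that is not periodic
is therefore strictly increasing along each of the finitely many chains, and converges there. The
map `f` sends the finite set of limits into itself, so one of the limits is periodic, and the
segment to it from a suitable point of the backward orbit expands. So every point of `T = ⋂ n,
range f^[n]` is periodic. Since distinct points of one periodic orbit lie in distinct chains, the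
periods are bounded, and `g = f^[N]` is the identity on `T` for some `N ≥ 1`
(`IsFiniteTree.exists_iterate_eq_self`). Finally, a map `g` that is the identity on `⋂ n, range
g^[n]` is equicontinuous (`IsFiniteTree.equicontinuous_of_iInterRange_fixed`), and with `g` so is
`f`.
-/

open Set Filter Topology

/-! ### Local path connectedness of locally connected compacta -/

/-- A compact, locally connected metric space is uniformly locally connected. -/
theorem exists_isPreconnected_of_dist_lt {X : Type*} [MetricSpace X] [CompactSpace X]
    [LocallyConnectedSpace X] {ε : ℝ} (hε : 0 < ε) :
    ∃ δ > 0, ∀ x y : X, dist x y < δ →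
      ∃ S : Set X, IsPreconnected S ∧ x ∈ S ∧ y ∈ S ∧ ∀ u ∈ S, dist u x ≤ ε := by
  obtain ⟨δ, hδ, h⟩ := lebesgue_number_lemma_of_metric (s := (univ : Set X))
    (c := fun x : X => connectedComponentIn (Metric.ball x (ε / 2)) x) isCompact_univ
    (fun x => Metric.isOpen_ball.connectedComponentIn)
    (fun x _ => mem_iUnion.2 ⟨x, mem_connectedComponentIn (Metric.mem_ball_self (by positivity))⟩)
  refine ⟨δ, hδ, fun x y hxy => ?_⟩
  obtain ⟨z, hz⟩ := h x (mem_univ x)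
  refine ⟨_, isPreconnected_connectedComponentIn, hz (Metric.mem_ball_self hδ),
    hz (by rwa [Metric.mem_ball, dist_comm]), fun u hu => ?_⟩
  have h1 := connectedComponentIn_subset _ _ hu
  have h2 := connectedComponentIn_subset _ _ (hz (Metric.mem_ball_self hδ))
  rw [Metric.mem_ball] at h1 h2
  have := dist_triangle_right u x z
  linarith

/-- In a preconnected set any two points are joined by a finite chain of points with small steps;
the chain is written as an eventually constant sequence. -/
theorem IsPreconnected.exists_chain {X : Type*} [MetricSpace X] {S : Set X}
    (hS : IsPreconnected S) {δ : ℝ} (hδ : 0 < δ) {x y : X} (hx : x ∈ S) (hy : y ∈ S) :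
    ∃ (m : ℕ) (c : ℕ → X), c 0 = x ∧ (∀ i, m ≤ i → c i = y) ∧ (∀ i, c i ∈ S) ∧
      ∀ i, dist (c i) (c (i + 1)) < δ := by
  refine hS.induction₂' (fun x y => ∃ (m : ℕ) (c : ℕ → X), c 0 = x ∧ (∀ i, m ≤ i → c i = y) ∧
    (∀ i, c i ∈ S) ∧ ∀ i, dist (c i) (c (i + 1)) < δ) ?_ ?_ hx hy
  · intro x hx
    have key : ∀ x ∈ S, ∀ y ∈ S, dist x y < δ → ∃ (m : ℕ) (c : ℕ → X), c 0 = x ∧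
        (∀ i, m ≤ i → c i = y) ∧ (∀ i, c i ∈ S) ∧ ∀ i, dist (c i) (c (i + 1)) < δ := by
      intro x hx y hy h
      refine ⟨1, fun i => if i = 0 then x else y, by simp, fun i hi => ?_, fun i => ?_, fun i => ?_⟩
      · simp [Nat.one_le_iff_ne_zero.1 hi]
      · dsimp only
        split_ifs <;> assumption
      · dsimp only
        split_ifs <;> simp_all
    filter_upwards [self_mem_nhdsWithin, nhdsWithin_le_nhds (Metric.ball_mem_nhds x hδ)] with y hy h
    exact ⟨key x hx y hy (by rwa [dist_comm]), key y hy x hx h⟩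
  · rintro x y z - - - ⟨m, c, h0, hm, hS, hd⟩ ⟨m', c', h0', hm', hS', hd'⟩
    refine ⟨m + m', fun i => if i < m then c i else c' (i - m), ?_, fun i hi => ?_, fun i => ?_,
      fun i => ?_⟩
    · rcases Nat.eq_zero_or_pos m with rfl | h
      · simp [h0', ← h0, hm 0 le_rfl]
      · simp [h, h0]
    · have h : ¬ i < m := by omega
      simp only [h, if_false]
      exact hm' _ (by omega)
    · dsimp only
      split_ifs
      exacts [hS _, hS' _]
    · dsimp only
      split_ifs with h1 h2 h2
      · exact hd i
      · have : i + 1 - m = 0 := by omega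
        rw [this, h0', ← hm (i + 1) (by omega)]
        exact hd i
      · omega
      · have : i + 1 - m = i - m + 1 := by omega
        rw [this]
        exact hd' _

/-- One refinement step: a chain with small steps is subdivided, every step into the same number
`M` of much smaller ones that stay close to the original point. -/
theorem exists_chain_refinement {X : Type*} [MetricSpace X] {δ δ' η : ℝ} (hδ' : 0 < δ')
    (hη : ∀ x y : X, dist x y < δ →
      ∃ S : Set X, IsPreconnected S ∧ x ∈ S ∧ y ∈ S ∧ ∀ u ∈ S, dist u x ≤ η)
    (y : X) (N : ℕ) (g : ℕ → X) (hg : ∀ j, dist (g j) (g (j + 1)) < δ)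
    (hN : ∀ j, N ≤ j → g j = y) :
    ∃ (M : ℕ) (g' : ℕ → X), 0 < M ∧ g' 0 = g 0 ∧ (∀ j, dist (g' j) (g' (j + 1)) < δ') ∧
      (∀ j, N * M ≤ j → g' j = y) ∧ ∀ k, dist (g' k) (g (k / M)) ≤ η := by
  have hc : ∀ j, ∃ (m : ℕ) (c : ℕ → X), c 0 = g j ∧ (∀ i, m ≤ i → c i = g (j + 1)) ∧
      (∀ i, dist (c i) (g j) ≤ η) ∧ ∀ i, dist (c i) (c (i + 1)) < δ' := by
    intro j
    obtain ⟨S, hS, h1, h2, h3⟩ := hη _ _ (hg j)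
    obtain ⟨m, c, a1, a2, a3, a4⟩ := hS.exists_chain hδ' h1 h2
    exact ⟨m, c, a1, a2, fun i => h3 _ (a3 i), a4⟩
  choose m c h0 hm hη' hd using hc
  have hη0 : 0 ≤ η := dist_nonneg.trans (hη' 0 0)
  set M := 1 + ∑ j ∈ Finset.range N, m j with hM
  have hmM : ∀ j < N, m j ≤ M := fun j hj =>
    (Finset.single_le_sum (f := m) (fun _ _ => Nat.zero_le _) (Finset.mem_range.2 hj)).trans
      (by omega)
  have hM0 : 0 < M := by omega
  refine ⟨M, fun k => if k / M < N then c (k / M) (k % M) else y, hM0, ?_, fun k => ?_,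
    fun k hk => ?_, fun k => ?_⟩
  · rcases Nat.eq_zero_or_pos N with rfl | h
    · simp [hN 0 le_rfl]
    · simp [h, h0]
  · dsimp only
    by_cases hk : k % M + 1 < M
    · have e1 : (k + 1) / M = k / M := by
        rw [Nat.div_eq_iff hM0]
        have := Nat.div_add_mod k M
        have := Nat.mul_comm M (k / M)
        constructor <;> lia
      have e2 : (k + 1) % M = k % M + 1 := by
        have h1 := Nat.div_add_mod k M
        have h2 := Nat.div_add_mod (k + 1) M
        rw [e1] at h2
        omega
      rw [e1, e2]
      split_ifs
      · exact hd _ _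
      · simpa using hδ'
    · have hlt := Nat.mod_lt k hM0
      have e0 : k % M + 1 = M := by omega
      have e1 : (k + 1) / M = k / M + 1 := by
        rw [Nat.div_eq_iff hM0]
        have := Nat.div_add_mod k M
        have := Nat.mul_comm M (k / M)
        constructor <;> lia
      have e2 : (k + 1) % M = 0 := by
        have h1 := Nat.div_add_mod k M
        have h2 := Nat.div_add_mod (k + 1) M
        rw [e1, Nat.mul_add] at h2
        omega
      rw [e1, e2, h0]
      by_cases hlt : k / M < N
      · have : (if k / M + 1 < N then g (k / M + 1) else y) = c (k / M) (k % M + 1) := by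
          rw [hm _ _ ((hmM _ hlt).trans e0.ge)]
          split_ifs with h
          · rfl
          · exact (hN _ (by omega)).symm
        rw [this, if_pos hlt]
        exact hd _ _
      · rw [if_neg hlt, if_neg (by omega)]
        simpa using hδ'
  · have : N ≤ k / M := (Nat.le_div_iff_mul_le hM0).2 hk
    simp [this]
  · dsimp only
    split_ifs with h
    · exact hη' _ _
    · rw [hN _ (by omega)]
      simpa using hη0

/-- Close points are joined by a small path. It is the uniform limit of step functions: the chain
of stage `n` has `N n` steps, each of which the next stage divides into equally many, and `γ n`
runs through it at constant speed. -/
theorem exists_path_of_dist_lt {X : Type*} [MetricSpace X] [CompactSpace X]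
    [LocallyConnectedSpace X] {C : ℝ} (hC : 0 < C) :
    ∃ δ > 0, ∀ x y : X, dist x y < δ →
      ∃ γ : ℝ → X, Continuous γ ∧ γ 0 = x ∧ γ 1 = y ∧ ∀ t, dist (γ t) x ≤ 2 * C := by
  have hη : ∀ n : ℕ, 0 < C / 2 / 2 ^ n := fun n => by positivity
  choose δ' hδ' hS' using fun n => exists_isPreconnected_of_dist_lt (X := X) (hη n)
  obtain ⟨δ, hδ, hδC, hS⟩ : ∃ δ : ℕ → ℝ, (∀ n, 0 < δ n) ∧ (∀ n, δ n ≤ C / 2 ^ n) ∧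
      ∀ n, ∀ x y : X, dist x y < δ n →
        ∃ S : Set X, IsPreconnected S ∧ x ∈ S ∧ y ∈ S ∧ ∀ u ∈ S, dist u x ≤ C / 2 / 2 ^ n :=
    ⟨fun n => min (δ' n) (C / 2 ^ n), fun n => lt_min (hδ' n) (by positivity),
      fun n => min_le_right _ _, fun n x y h => hS' n x y (h.trans_le (min_le_left _ _))⟩
  refine ⟨δ 0, hδ 0, fun x y hxy => ?_⟩
  let P : ℕ → ℕ × (ℕ → X) → Prop := fun n s => 0 < s.1 ∧ s.2 0 = x ∧
    (∀ j, dist (s.2 j) (s.2 (j + 1)) < δ n) ∧ ∀ j, s.1 ≤ j → s.2 j = y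
  have step : ∀ n (s : {s // P n s}), ∃ s' : {s // P (n + 1) s}, ∃ M : ℕ, 0 < M ∧
      s'.1.1 = s.1.1 * M ∧ ∀ k, dist (s'.1.2 k) (s.1.2 (k / M)) ≤ C / 2 / 2 ^ n := by
    rintro n ⟨⟨N, g⟩, h1, h2, h3, h4⟩
    obtain ⟨M, g', a1, a2, a3, a4, a5⟩ :=
      exists_chain_refinement (hδ (n + 1)) (hS n) y N g h3 h4
    exact ⟨⟨⟨N * M, g'⟩, Nat.mul_pos h1 a1, a2.trans h2, a3, a4⟩, M, a1, rfl, a5⟩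
  choose F M hM hFM hF using step
  let s0 : {s // P 0 s} := ⟨⟨1, fun j => if j = 0 then x else y⟩, one_pos, by simp, fun j => by
    rcases Nat.eq_zero_or_pos j with rfl | hj
    · simpa using hxy
    · simpa [hj.ne'] using hδ 0, fun j hj => by
    simp [show j ≠ 0 from Nat.one_le_iff_ne_zero.1 hj]⟩
  let s : ∀ n, {s // P n s} := fun n => Nat.rec s0 F n
  let N : ℕ → ℕ := fun n => (s n).1.1
  let γ : ℕ → ℝ → X := fun n t => (s n).1.2 ⌊(N n : ℝ) * t⌋₊
  have hN : ∀ n, 0 < N n := fun n => (s n).2.1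
  have hγ : ∀ t n, dist (γ n t) (γ (n + 1) t) ≤ C / 2 / 2 ^ n := by
    intro t n
    have h := hF n (s n) ⌊(N (n + 1) : ℝ) * t⌋₊
    -- The subdivision is uniform, so stage `n + 1` is, at each time, inside the current step.
    have e : ⌊(N (n + 1) : ℝ) * t⌋₊ / M n (s n) = ⌊(N n : ℝ) * t⌋₊ := by
      rw [← Nat.floor_div_natCast]
      congr 1
      have : N (n + 1) = N n * M n (s n) := hFM n (s n)
      have hM' : (M n (s n) : ℝ) ≠ 0 := by exact_mod_cast (hM n (s n)).ne'
      rw [this]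
      push_cast
      field_simp
    rw [e] at h
    rw [dist_comm]
    exact h
  have hlim : ∀ t, ∃ z, Tendsto (fun n => γ n t) atTop (𝓝 z) := fun t =>
    cauchySeq_tendsto_of_complete (cauchySeq_of_le_geometric_two (hγ t))
  choose Γ hΓ using hlim
  have hdist : ∀ n t, dist (γ n t) (Γ t) ≤ C / 2 ^ n := fun n t =>
    dist_le_of_le_geometric_two_of_tendsto (hγ t) (hΓ t) n
  have hjump : ∀ n (t t' : ℝ), |t' - t| < 1 / N n → dist (γ n t') (γ n t) ≤ C / 2 ^ n := by
    have key : ∀ n (t t' : ℝ), t ≤ t' → t' - t < 1 / N n → dist (γ n t') (γ n t) ≤ C / 2 ^ n := by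
      intro n t t' htt h
      have hn : (0 : ℝ) < N n := by exact_mod_cast hN n
      have h1 : ⌊(N n : ℝ) * t⌋₊ ≤ ⌊(N n : ℝ) * t'⌋₊ :=
        Nat.floor_mono (mul_le_mul_of_nonneg_left htt hn.le)
      have h2 : ⌊(N n : ℝ) * t'⌋₊ ≤ ⌊(N n : ℝ) * t⌋₊ + 1 := by
        rw [← Nat.lt_succ_iff, Nat.floor_lt' (by omega)]
        have := Nat.lt_floor_add_one ((N n : ℝ) * t)
        rw [lt_div_iff₀ hn] at h
        push_cast
        linarith
      rcases h1.eq_or_lt with h3 | h3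
      · simp only [γ]
        rw [← h3, dist_self]
        positivity
      · have : ⌊(N n : ℝ) * t'⌋₊ = ⌊(N n : ℝ) * t⌋₊ + 1 := by omega
        simp only [γ]
        rw [this, dist_comm]
        exact ((s n).2.2.2.1 _).le.trans (hδC n)
    intro n t t' h
    rcases le_total t t' with h' | h'
    · exact key n t t' h' ((le_abs_self _).trans_lt h)
    · rw [dist_comm]
      exact key n t' t h' (by rw [abs_sub_comm] at h; exact (le_abs_self _).trans_lt h)
  refine ⟨Γ, ?_, ?_, ?_, fun t => ?_⟩
  · rw [Metric.continuous_iff]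
    intro t ε hε
    obtain ⟨n, hn⟩ : ∃ n : ℕ, C / 2 ^ n < ε / 3 := by
      obtain ⟨n, hn⟩ := exists_pow_lt_of_lt_one (show 0 < ε / 3 / C by positivity)
        (show (1 / 2 : ℝ) < 1 by norm_num)
      refine ⟨n, ?_⟩
      rw [lt_div_iff₀ hC] at hn
      calc C / 2 ^ n = (1 / 2) ^ n * C := by rw [one_div, inv_pow]; ring
        _ < ε / 3 := hn
    have hn' : (0 : ℝ) < N n := by exact_mod_cast hN n
    refine ⟨1 / N n, by positivity, fun t' ht' => ?_⟩
    have h1 := hjump n t t' ht'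
    have h2 := hdist n t
    have h3 := hdist n t'
    have h4 := dist_triangle4 (Γ t') (γ n t') (γ n t) (Γ t)
    rw [dist_comm (Γ t') (γ n t')] at h4
    linarith
  · refine tendsto_nhds_unique (hΓ 0) ?_
    have : ∀ n, γ n 0 = x := fun n => by simpa [γ] using (s n).2.2.1
    simp [this]
  · refine tendsto_nhds_unique (hΓ 1) ?_
    have : ∀ n, γ n 1 = y := fun n => by
      simp only [γ, mul_one, Nat.floor_natCast]
      exact (s n).2.2.2.2 _ le_rfl
    simp [this]
  · have h1 := hdist 0 t
    have h2 : dist (γ 0 t) x ≤ C := by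
      have e : γ 0 t = if ⌊(N 0 : ℝ) * t⌋₊ = 0 then x else y := rfl
      rw [e]
      split_ifs
      · simpa using hC.le
      · rw [dist_comm]
        simpa using hxy.le.trans (hδC 0)
    have h3 := dist_triangle_left (Γ t) x (γ 0 t)
    simp only [pow_zero, div_one] at h1
    linarith

theorem locallyPathConnectedSpace_of_compactSpace {X : Type*} [MetricSpace X] [CompactSpace X]
    [LocallyConnectedSpace X] : LocallyPathConnectedSpace X where
  path_connected_basis x := by
    rw [hasBasis_self]
    intro U hU
    obtain ⟨ε, hε, hεU⟩ := Metric.mem_nhds_iff.1 hU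
    obtain ⟨δ, hδ, h⟩ := exists_path_of_dist_lt (X := X) (show 0 < ε / 3 by positivity)
    refine ⟨pathComponentIn (Metric.ball x ε) x, ?_, isPathConnected_pathComponentIn
      (Metric.mem_ball_self hε), pathComponentIn_subset.trans hεU⟩
    filter_upwards [Metric.ball_mem_nhds x hδ] with y hy
    obtain ⟨γ, hγ, h0, h1, hd⟩ := h x y (by rwa [dist_comm])
    refine ⟨⟨⟨fun t => γ t, by fun_prop⟩, by simpa using h0, by simpa using h1⟩, fun t => ?_⟩
    have := hd t
    simp only [Path.coe_mk_mk, Metric.mem_ball]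
    linarith

/-! ### Arcs in the image of a path -/

/-- Every path contains a loop-free set of parameters: a closed set `K` of times such that the
path agrees at the two ends of every gap of `K`, and such that times in `K` at which the path
agrees are the ends of a gap. It is a minimal closed set with the former property. -/
theorem exists_loop_free_times {X : Type*} [MetricSpace X] {γ : ℝ → X} (hγ : Continuous γ) :
    ∃ K ⊆ Icc (0 : ℝ) 1, IsClosed K ∧ 0 ∈ K ∧ 1 ∈ K ∧
      (∀ s ∈ K, ∀ t ∈ K, s < t → K ∩ Ioo s t = ∅ → γ s = γ t) ∧
      ∀ s ∈ K, ∀ t ∈ K, s < t → γ s = γ t → K ∩ Ioo s t = ∅ := by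
  let F : Set (Set ℝ) := {K | K ⊆ Icc (0 : ℝ) 1 ∧ IsClosed K ∧ 0 ∈ K ∧ 1 ∈ K ∧
    ∀ s ∈ K, ∀ t ∈ K, s < t → K ∩ Ioo s t = ∅ → γ s = γ t}
  have hI : Icc (0 : ℝ) 1 ∈ F := by
    refine ⟨Subset.rfl, isClosed_Icc, by simp, by simp, fun s hs t ht hst h => ?_⟩
    exact absurd h (Nonempty.ne_empty ⟨(s + t) / 2, ⟨by linarith [hs.1, ht.1], by
      linarith [hs.2, ht.2]⟩, by linarith, by linarith⟩)
  have hchain : ∀ c ⊆ F, IsChain (· ⊆ ·) c → c.Nonempty → ∃ K ∈ F, ∀ L ∈ c, K ⊆ L := by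
    intro c hcF hc hne
    have hcl : IsClosed (⋂₀ c) := isClosed_sInter fun K hK => (hcF hK).2.1
    obtain ⟨K₀, hK₀⟩ := hne
    refine ⟨⋂₀ c, ⟨(sInter_subset_of_mem hK₀).trans (hcF hK₀).1, hcl,
      fun K hK => (hcF hK).2.2.1, fun K hK => (hcF hK).2.2.2.1, fun s hs t ht hst hgap => ?_⟩,
      fun K hK => sInter_subset_of_mem hK⟩
    refine eq_of_forall_dist_le fun ε hε => ?_
    obtain ⟨η₁, hη₁, h₁⟩ := Metric.continuous_iff.1 hγ s (ε / 2) (by positivity)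
    obtain ⟨η₂, hη₂, h₂⟩ := Metric.continuous_iff.1 hγ t (ε / 2) (by positivity)
    -- A margin keeping `s + η` and `t - η` inside the gap and close to its ends.
    obtain ⟨η, hη, ha, hb, hd⟩ : ∃ η > 0, η < η₁ ∧ η < η₂ ∧ η < (t - s) / 2 := by
      obtain ⟨η, h, h'⟩ := exists_between (lt_min (lt_min hη₁ hη₂)
        (show 0 < (t - s) / 2 by linarith))
      simp only [lt_min_iff] at h'
      exact ⟨η, h, h'.1.1, h'.1.2, h'.2⟩
    obtain ⟨K, hK, hKe⟩ : ∃ K ∈ c, Icc (s + η) (t - η) ∩ K = ∅ := by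
      have : Nonempty c := ⟨⟨K₀, hK₀⟩⟩
      obtain ⟨⟨K, hK⟩, h⟩ := isCompact_Icc.elim_directed_family_closed
        (s := Icc (s + η) (t - η)) (fun K : c => (K : Set ℝ)) (fun K => (hcF K.2).2.1)
        (by
          rw [← sInter_eq_iInter]
          refine eq_empty_of_forall_notMem fun w hw => hgap.le ⟨hw.2, ?_, ?_⟩
          · linarith [hw.1.1]
          · linarith [hw.1.2])
        (fun a b => by
          rcases hc.total a.2 b.2 with h | h
          exacts [⟨a, Subset.rfl, h⟩, ⟨b, h, Subset.rfl⟩])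
      exact ⟨K, hK, h⟩
    obtain ⟨-, hKc, -, -, hKg⟩ := hcF hK
    have c1 : IsCompact (K ∩ Icc s (s + η)) := isCompact_Icc.inter_left hKc
    have c2 : IsCompact (K ∩ Icc (t - η) t) := isCompact_Icc.inter_left hKc
    obtain ⟨s', ⟨hs', hs'm⟩, hs''⟩ := c1.exists_isGreatest ⟨s, hs K hK, le_rfl, by linarith⟩
    obtain ⟨t', ⟨ht', ht'm⟩, ht''⟩ := c2.exists_isLeast ⟨t, ht K hK, by linarith, le_rfl⟩
    have e : γ s' = γ t' := by
      refine hKg s' hs' t' ht' (by linarith [hs'm.2, ht'm.1]) (eq_empty_of_forall_notMem ?_)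
      rintro w ⟨hw, hw1, hw2⟩
      rcases le_total w (s + η) with h | h
      · exact absurd (hs'' ⟨hw, by linarith [hs'm.1], h⟩) (not_le.2 hw1)
      · rcases le_total (t - η) w with h' | h'
        · exact absurd (ht'' ⟨hw, h', by linarith [ht'm.2]⟩) (not_le.2 hw2)
        · exact hKe.le ⟨⟨h, h'⟩, hw⟩
    have d1 := h₁ s' (by rw [Real.dist_eq, abs_lt]; constructor <;> linarith [hs'm.1, hs'm.2])
    have d2 := h₂ t' (by rw [Real.dist_eq, abs_lt]; constructor <;> linarith [ht'm.1, ht'm.2])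
    have := dist_triangle_left (γ s) (γ t) (γ s')
    rw [← e] at d2
    linarith
  obtain ⟨K, -, hK⟩ := zorn_superset_nonempty F hchain _ hI
  obtain ⟨⟨h1, h2, h3, h4, h5⟩, hmin⟩ := hK
  refine ⟨K, h1, h2, h3, h4, h5, fun s hs t ht hst he => ?_⟩
  have hK' : K \ Ioo s t ∈ F := by
    refine ⟨sdiff_subset.trans h1, h2.sdiff isOpen_Ioo, ⟨h3, fun h => ?_⟩, ⟨h4, fun h => ?_⟩,
      fun u hu v hv huv huv' => ?_⟩
    · exact absurd h.1 (not_lt.2 (h1 hs).1)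
    · exact absurd h.2 (not_lt.2 (h1 ht).2)
    · have hs' : ¬ (u < s ∧ s < v) := fun h =>
        (huv'.le ⟨⟨hs, fun h => lt_irrefl _ h.1⟩, h⟩).elim
      have ht' : ¬ (u < t ∧ t < v) := fun h =>
        (huv'.le ⟨⟨ht, fun h => lt_irrefl _ h.2⟩, h⟩).elim
      have hu' := hu.2
      have hv' := hv.2
      simp only [mem_Ioo, not_and_or, not_lt] at hu' hv' hs' ht'
      by_cases hgap : u = s ∧ v = t
      · rw [hgap.1, hgap.2, he]
      refine h5 u hu.1 v hv.1 huv (eq_empty_of_forall_notMem fun w hw => huv'.le ⟨⟨hw.1,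
        fun hw' => hgap ?_⟩, hw.2⟩)
      obtain ⟨-, hw1, hw2⟩ := hw
      obtain ⟨hw3, hw4⟩ := hw'
      constructor
      · rcases hu' with h | h <;> rcases hs' with h' | h' <;> linarith
      · rcases hv' with h | h <;> rcases ht' with h' | h' <;> linarith
  have := hmin hK' sdiff_subset
  exact eq_empty_of_forall_notMem fun w hw => (this hw.1).2 hw.2

/-- Every path may be replaced by one whose fibres are intervals: wait during the gaps of a
loop-free set of times. -/
theorem exists_monotone_path {X : Type*} [MetricSpace X] {γ : ℝ → X} (hγ : Continuous γ) :
    ∃ β : ℝ → X, ContinuousOn β (Icc 0 1) ∧ β 0 = γ 0 ∧ β 1 = γ 1 ∧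
      β '' Icc 0 1 ⊆ γ '' Icc 0 1 ∧
      ∀ s ∈ Icc (0 : ℝ) 1, ∀ t ∈ Icc (0 : ℝ) 1, β s = β t → ∀ u ∈ Icc s t, β u = β s := by
  obtain ⟨K, hKI, hKc, h0, h1, hgap, hloop⟩ := exists_loop_free_times hγ
  -- `ρ u` is the last time in `K` up to `u`.
  have hρ : ∀ u : ℝ, ∃ r, u ∈ Icc (0 : ℝ) 1 → IsGreatest (K ∩ Icc 0 u) r := by
    intro u
    by_cases hu : u ∈ Icc (0 : ℝ) 1
    · obtain ⟨r, hr⟩ := (isCompact_Icc.inter_left hKc : IsCompact (K ∩ Icc 0 u)).exists_isGreatest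
        ⟨0, h0, le_rfl, hu.1⟩
      exact ⟨r, fun _ => hr⟩
    · exact ⟨0, fun h => absurd h hu⟩
  choose ρ hρ using hρ
  have hρK : ∀ u ∈ Icc (0 : ℝ) 1, ρ u ∈ K := fun u hu => (hρ u hu).1.1
  have hρle : ∀ u ∈ Icc (0 : ℝ) 1, ρ u ≤ u := fun u hu => (hρ u hu).1.2.2
  have hρmax : ∀ u ∈ Icc (0 : ℝ) 1, ∀ k ∈ K, k ≤ u → k ≤ ρ u := fun u hu k hk hku =>
    (hρ u hu).2 ⟨hk, (hKI hk).1, hku⟩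
  have hρmono : ∀ u ∈ Icc (0 : ℝ) 1, ∀ v ∈ Icc (0 : ℝ) 1, u ≤ v → ρ u ≤ ρ v :=
    fun u hu v hv huv => hρmax v hv _ (hρK u hu) ((hρle u hu).trans huv)
  have hρid : ∀ u ∈ K, ρ u = u := fun u hu =>
    le_antisymm (hρle u (hKI hu)) (hρmax u (hKI hu) u hu le_rfl)
  refine ⟨fun u => γ (ρ u), ?_, by simp only [hρid 0 h0], by simp only [hρid 1 h1], ?_, ?_⟩
  · have huc : UniformContinuousOn γ (Icc 0 1) :=
      isCompact_Icc.uniformContinuousOn_of_continuous hγ.continuousOn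
    rw [Metric.uniformContinuousOn_iff] at huc
    refine (Metric.uniformContinuousOn_iff.2 fun ε hε => ?_).continuousOn
    obtain ⟨δ, hδ, h⟩ := huc ε hε
    refine ⟨δ, hδ, ?_⟩
    have key : ∀ u ∈ Icc (0 : ℝ) 1, ∀ v ∈ Icc (0 : ℝ) 1, u ≤ v → dist u v < δ →
        dist (γ (ρ u)) (γ (ρ v)) < ε := by
      intro u hu v hv huv huv'
      by_cases hvu : ρ v ≤ u
      · rw [le_antisymm (hρmono u hu v hv huv) (hρmax u hu _ (hρK v hv) hvu), dist_self]
        exact hε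
      · push Not at hvu
        -- The first time `w` in `K` after `u`: the path agrees at `ρ u` and at `w`.
        obtain ⟨w, ⟨hwK, hw⟩, hwmin⟩ :=
          (isCompact_Icc.inter_left hKc : IsCompact (K ∩ Icc u 1)).exists_isLeast
            ⟨1, h1, hu.2, le_rfl⟩
        have hwv : w ≤ ρ v := hwmin ⟨hρK v hv, hvu.le, (hKI (hρK v hv)).2⟩
        have e : γ (ρ u) = γ w := by
          rcases ((hρle u hu).trans hw.1).eq_or_lt with h | h
          · rw [h]
          · refine hgap _ (hρK u hu) w hwK h (eq_empty_of_forall_notMem ?_)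
            rintro z ⟨hz, hz1, hz2⟩
            rcases le_total z u with h' | h'
            · exact absurd (hρmax u hu z hz h') (not_le.2 hz1)
            · exact absurd (hwmin ⟨hz, h', (hKI hz).2⟩) (not_le.2 hz2)
        rw [e]
        refine h w (hKI hwK) _ (hKI (hρK v hv)) (lt_of_le_of_lt ?_ huv')
        rw [Real.dist_eq, Real.dist_eq, abs_of_nonpos (by linarith), abs_of_nonpos (by linarith)]
        linarith [hw.1, hρle v hv]
    intro u hu v hv huv
    rcases le_total u v with h' | h'
    · exact key u hu v hv h' huv
    · rw [dist_comm]
      exact key v hv u hu h' (by rwa [dist_comm])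
  · rintro _ ⟨u, hu, rfl⟩
    exact ⟨ρ u, hKI (hρK u hu), rfl⟩
  · intro s hs t ht hst u hu
    have huI : u ∈ Icc (0 : ℝ) 1 := ⟨hs.1.trans hu.1, hu.2.trans ht.2⟩
    have a := hρmono s hs u huI hu.1
    have b := hρmono u huI t ht hu.2
    rcases a.eq_or_lt with a' | a'
    · simp only [a']
    · rcases b.eq_or_lt with b' | b'
      · simp only [b', hst]
      · exact ((hloop _ (hρK s hs) _ (hρK t ht) (a'.trans b') hst).le ⟨hρK u huI, a', b'⟩).elim

/-- A nonconstant path whose fibres are intervals can be reparametrised to be injective. The new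
parameter at time `u` is, up to normalisation, the total distance of the path from its initial
piece up to time `u`, integrated over the path. -/
theorem exists_injOn_reparametrization {X : Type*} [MetricSpace X] {b : ℝ → X} (hb : Continuous b)
    (hne : b 0 ≠ b 1)
    (hmono : ∀ s ∈ Icc (0 : ℝ) 1, ∀ t ∈ Icc (0 : ℝ) 1, b s = b t → ∀ u ∈ Icc s t, b u = b s) :
    ∃ α : ℝ → X, ContinuousOn α (Icc 0 1) ∧ InjOn α (Icc 0 1) ∧ α 0 = b 0 ∧ α 1 = b 1 ∧
      α '' Icc 0 1 ⊆ b '' Icc 0 1 := by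
  -- `D u v` is the distance of `b v` from `b '' [0, u]`.
  let D : ℝ → ℝ → ℝ := fun u v => sInf ((fun r => dist (b v) (b (r * u))) '' Icc (0 : ℝ) 1)
  have hDc : Continuous (Function.uncurry D) := by
    have : Continuous fun p : ℝ × ℝ =>
        sInf ((fun r : ℝ => dist (b p.2) (b (r * p.1))) '' Icc (0 : ℝ) 1) := by
      refine IsCompact.continuous_sInf isCompact_Icc ?_
      simp only [Function.HasUncurry.uncurry, id]
      fun_prop
    exact this
  have hDv : ∀ u, Continuous (D u) := fun u => hDc.comp (by fun_prop : Continuous fun v => (u, v))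
  have hDle : ∀ u v s, s ∈ Icc 0 u → D u v ≤ dist (b v) (b s) := by
    intro u v s hs
    refine csInf_le ⟨0, by rintro _ ⟨r, -, rfl⟩; exact dist_nonneg⟩ ?_
    rcases hs.1.eq_or_lt with h | h
    · exact ⟨0, by simp, by simp [← h]⟩
    · have hu : 0 < u := h.trans_le hs.2
      exact ⟨s / u, ⟨by positivity, (div_le_one hu).2 hs.2⟩, by simp [hu.ne']⟩
  have hDex : ∀ u v, 0 ≤ u → ∃ s ∈ Icc 0 u, D u v = dist (b v) (b s) := by
    intro u v hu
    obtain ⟨r, hr, he⟩ := (isCompact_Icc (a := (0 : ℝ)) (b := 1)).exists_sInf_image_eq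
      ⟨0, by simp⟩ (f := fun r => dist (b v) (b (r * u))) (by fun_prop)
    exact ⟨r * u, ⟨mul_nonneg hr.1 hu, mul_le_of_le_one_left hu hr.2⟩, he⟩
  have hDanti : ∀ u u' v, 0 ≤ u → u ≤ u' → D u' v ≤ D u v := by
    intro u u' v hu huu
    obtain ⟨s, hs, he⟩ := hDex u v hu
    rw [he]
    exact hDle u' v s ⟨hs.1, hs.2.trans huu⟩
  let ψ : ℝ → ℝ := fun u => -∫ v in (0 : ℝ)..1, D u v
  have hψc : Continuous ψ :=
    (intervalIntegral.continuous_parametric_intervalIntegral_of_continuous' hDc 0 1).neg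
  have hψeq : ∀ u ∈ Icc (0 : ℝ) 1, ∀ u' ∈ Icc (0 : ℝ) 1, u ≤ u' → b u = b u' → ψ u = ψ u' := by
    intro u hu u' hu' huu he
    have : D u = D u' := by
      funext v
      refine le_antisymm ?_ (hDanti u u' v hu.1 huu)
      obtain ⟨s, hs, hs'⟩ := hDex u' v hu'.1
      rw [hs']
      rcases le_total s u with h | h
      · exact hDle u v s ⟨hs.1, h⟩
      · rw [hmono u hu u' hu' he s ⟨h, hs.2⟩]
        exact hDle u v u ⟨hu.1, le_rfl⟩
    simp only [ψ, this]
  have hψlt : ∀ u ∈ Icc (0 : ℝ) 1, ∀ u' ∈ Icc (0 : ℝ) 1, u ≤ u' → b u ≠ b u' → ψ u < ψ u' := by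
    intro u hu u' hu' huu hn
    refine neg_lt_neg (intervalIntegral.integral_lt_integral_of_continuousOn_of_le_of_exists_lt
      one_pos (hDv u').continuousOn (hDv u).continuousOn (fun v _ => hDanti u u' v hu.1 huu)
      ⟨u', hu', ?_⟩)
    have h1 : D u' u' ≤ 0 := (hDle u' u' u' ⟨hu'.1, le_rfl⟩).trans_eq (dist_self _)
    obtain ⟨s, hs, hs'⟩ := hDex u u' hu.1
    refine h1.trans_lt ?_
    rw [hs', dist_pos]
    intro he
    have hsI : s ∈ Icc (0 : ℝ) 1 := ⟨hs.1, hs.2.trans hu.2⟩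
    exact hn ((hmono s hsI u' hu' he.symm u ⟨hs.2, huu⟩).trans he.symm)
  have hψiff : ∀ u ∈ Icc (0 : ℝ) 1, ∀ u' ∈ Icc (0 : ℝ) 1, ψ u = ψ u' ↔ b u = b u' := by
    intro u hu u' hu'
    rcases le_total u u' with h | h
    · exact ⟨fun he => by_contra fun hn => (hψlt u hu u' hu' h hn).ne he, hψeq u hu u' hu' h⟩
    · exact ⟨fun he => by_contra fun hn => (hψlt u' hu' u hu h (Ne.symm hn)).ne he.symm,
        fun he => (hψeq u' hu' u hu h he.symm).symm⟩
  have h0I : (0 : ℝ) ∈ Icc (0 : ℝ) 1 := by simp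
  have h1I : (1 : ℝ) ∈ Icc (0 : ℝ) 1 := by simp
  have h01 : 0 < ψ 1 - ψ 0 := sub_pos.2 (hψlt 0 h0I 1 h1I zero_le_one hne)
  let φ : ℝ → ℝ := fun u => (ψ u - ψ 0) / (ψ 1 - ψ 0)
  have hφc : Continuous φ := by fun_prop
  have hφ0 : φ 0 = 0 := by simp [φ]
  have hφ1 : φ 1 = 1 := by simp only [φ]; exact div_self h01.ne'
  have hφiff : ∀ u ∈ Icc (0 : ℝ) 1, ∀ u' ∈ Icc (0 : ℝ) 1, φ u = φ u' ↔ b u = b u' := by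
    intro u hu u' hu'
    rw [← hψiff u hu u' hu']
    simp only [φ]
    rw [div_left_inj' h01.ne', sub_left_inj]
  have hsurj : ∀ x, ∃ u, x ∈ Icc (0 : ℝ) 1 → u ∈ Icc (0 : ℝ) 1 ∧ φ u = x := by
    intro x
    by_cases hx : x ∈ Icc (0 : ℝ) 1
    · have := intermediate_value_Icc zero_le_one hφc.continuousOn
      rw [hφ0, hφ1] at this
      obtain ⟨u, hu, he⟩ := this hx
      exact ⟨u, fun _ => ⟨hu, he⟩⟩
    · exact ⟨0, fun h => absurd h hx⟩
  choose σ hσ using hsurj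
  have hbσ : ∀ u ∈ Icc (0 : ℝ) 1, φ u ∈ Icc (0 : ℝ) 1 → b (σ (φ u)) = b u := fun u hu hφu =>
    (hφiff _ (hσ _ hφu).1 u hu).1 (hσ _ hφu).2
  refine ⟨fun x => b (σ x), ?_, ?_, ?_, ?_, ?_⟩
  · rw [continuousOn_iff_isClosed]
    intro C hC
    refine ⟨φ '' (b ⁻¹' C ∩ Icc 0 1), ((isCompact_Icc.inter_left (hC.preimage hb)).image
      hφc).isClosed, ?_⟩
    ext x
    constructor
    · rintro ⟨hx, hxI⟩
      exact ⟨⟨σ x, ⟨hx, (hσ x hxI).1⟩, (hσ x hxI).2⟩, hxI⟩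
    · rintro ⟨⟨u, ⟨hu, huI⟩, rfl⟩, hxI⟩
      refine ⟨?_, hxI⟩
      rw [mem_preimage, hbσ u huI hxI]
      exact hu
  · intro x hx y hy hxy
    have := (hφiff _ (hσ x hx).1 _ (hσ y hy).1).2 hxy
    rwa [(hσ x hx).2, (hσ y hy).2] at this
  · have := hbσ 0 h0I (by simp [hφ0])
    rwa [hφ0] at this
  · have := hbσ 1 h1I (by simp [hφ1])
    rwa [hφ1] at this
  · rintro _ ⟨x, hx, rfl⟩
    exact ⟨σ x, (hσ x hx).1, rfl⟩

/-- The image of a path between distinct points of a metric space contains an arc between them. -/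
theorem exists_injOn_path {X : Type*} [MetricSpace X] {γ : ℝ → X} (hγ : Continuous γ)
    (hne : γ 0 ≠ γ 1) :
    ∃ α : ℝ → X, ContinuousOn α (Icc 0 1) ∧ InjOn α (Icc 0 1) ∧ α 0 = γ 0 ∧ α 1 = γ 1 ∧
      α '' Icc 0 1 ⊆ γ '' Icc 0 1 := by
  obtain ⟨β, hβ, h0, h1, hsub, hmono⟩ := exists_monotone_path hγ
  let b : ℝ → X := fun t => β (projIcc (0 : ℝ) 1 zero_le_one t)
  have hb : Continuous b := hβ.comp_continuous (by fun_prop) (fun t => (projIcc _ _ _ t).2)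
  have hbβ : ∀ t ∈ Icc (0 : ℝ) 1, b t = β t := fun t ht => by
    simp only [b, projIcc_of_mem zero_le_one ht]
  have e0 := hbβ 0 (by simp)
  have e1 := hbβ 1 (by simp)
  obtain ⟨α, a1, a2, a3, a4, a5⟩ := exists_injOn_reparametrization hb (by rwa [e0, e1, h0, h1])
    (fun s hs t ht hst u hu => by
      have huI : u ∈ Icc (0 : ℝ) 1 := ⟨hs.1.trans hu.1, hu.2.trans ht.2⟩
      rw [hbβ s hs, hbβ t ht] at hst
      rw [hbβ s hs, hbβ u huI]
      exact hmono s hs t ht hst u hu)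
  refine ⟨α, a1, a2, a3.trans (e0.trans h0), a4.trans (e1.trans h1), a5.trans ?_⟩
  rintro _ ⟨t, ht, rfl⟩
  rw [hbβ t ht]
  exact hsub ⟨t, ht, rfl⟩

/-- In a compact, locally connected metric space, distinct points of a connected open set are
joined by an arc in it. -/
theorem IsOpen.exists_injOn_path {X : Type*} [MetricSpace X] [CompactSpace X]
    [LocallyConnectedSpace X] {U : Set X} (hU : IsOpen U) (hU' : IsPreconnected U) {x y : X}
    (hx : x ∈ U) (hy : y ∈ U) (hxy : x ≠ y) :
    ∃ α : ℝ → X, ContinuousOn α (Icc 0 1) ∧ InjOn α (Icc 0 1) ∧ α 0 = x ∧ α 1 = y ∧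
      α '' Icc 0 1 ⊆ U := by
  have : LocallyPathConnectedSpace X := locallyPathConnectedSpace_of_compactSpace
  have hpc : IsPathConnected U := hU.isConnected_iff_isPathConnected.1 ⟨⟨x, hx⟩, hU'⟩
  obtain ⟨γ, hγ⟩ := hpc.joinedIn x hx y hy
  obtain ⟨α, a1, a2, a3, a4, a5⟩ := _root_.exists_injOn_path γ.continuous_extend (by simpa)
  refine ⟨α, a1, a2, by simpa using a3, by simpa using a4, a5.trans ?_⟩
  rintro _ ⟨t, ht, rfl⟩
  rw [γ.extend_apply ht]
  exact hγ _

/-! ### Segments in dendrites -/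

/-- Two arcs with the same ends and no other common point form a simple closed curve. -/
theorem exists_isSimpleClosedCurve {X : Type*} [MetricSpace X] {α β : ℝ → X}
    (hα : ContinuousOn α (Icc 0 1)) (hβ : ContinuousOn β (Icc 0 1)) (hαi : InjOn α (Icc 0 1))
    (hβi : InjOn β (Icc 0 1)) (h0 : α 0 = β 0) (h1 : α 1 = β 1)
    (hαβ : ∀ s ∈ Icc (0 : ℝ) 1, ∀ t ∈ Ioo (0 : ℝ) 1, α s ≠ β t) :
    ∃ C : Set X, IsSimpleClosedCurve C := by
  have : Fact ((0 : ℝ) < 2) := ⟨two_pos⟩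
  let c : ℝ → X := fun t => if t ≤ 1 then α t else β (2 - t)
  have hc : ContinuousOn c (Icc 0 2) := by
    have : Icc (0 : ℝ) 2 = Icc 0 1 ∪ Icc 1 2 := (Icc_union_Icc_eq_Icc zero_le_one one_le_two).symm
    rw [this]
    refine ContinuousOn.union_of_isClosed ?_ ?_ isClosed_Icc isClosed_Icc
    · exact hα.congr fun t ht => if_pos ht.2
    · have : ContinuousOn (fun t : ℝ => β (2 - t)) (Icc 1 2) :=
        hβ.comp (by fun_prop) fun t ht => ⟨by linarith [ht.2], by linarith [ht.1]⟩
      refine this.congr fun t ht => ?_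
      rcases ht.1.eq_or_lt with h | h
      · subst h
        simp only [c, le_refl, if_true, h1]
        norm_num
      · exact if_neg (not_le.2 h)
  have hci : InjOn c (Ico 0 2) := by
    intro s hs t ht hst
    simp only [c] at hst
    split_ifs at hst with h h' h'
    · exact hαi ⟨hs.1, h⟩ ⟨ht.1, h'⟩ hst
    · exact (hαβ s ⟨hs.1, h⟩ (2 - t) ⟨by linarith [ht.2], by linarith⟩ hst).elim
    · exact (hαβ t ⟨ht.1, h'⟩ (2 - s) ⟨by linarith [hs.2], by linarith⟩ hst.symm).elim
    · have := hβi ⟨by linarith [hs.2], by linarith⟩ ⟨by linarith [ht.2], by linarith⟩ hst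
      linarith
  let F : AddCircle (2 : ℝ) → X := AddCircle.liftIco 2 0 c
  have hF : Continuous F := AddCircle.liftIco_zero_continuous (by simp [c, h0]) hc
  have hFi : Function.Injective F := by
    intro x y hxy
    obtain ⟨s, hs, rfl⟩ := (AddCircle.coe_image_Ico_eq (2 : ℝ) 0).ge (mem_univ x)
    obtain ⟨t, ht, rfl⟩ := (AddCircle.coe_image_Ico_eq (2 : ℝ) 0).ge (mem_univ y)
    rw [zero_add] at hs ht
    simp only [F] at hxy
    rw [AddCircle.liftIco_zero_coe_apply hs, AddCircle.liftIco_zero_coe_apply ht] at hxy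
    rw [hci hs ht hxy]
  exact ⟨range F, ⟨(hF.isClosedEmbedding hFi).isEmbedding.toHomeomorph.symm.trans
    (AddCircle.homeomorphCircle two_ne_zero)⟩⟩

/-- In a dendrite, a connected set containing the ends of an arc contains the whole arc. Otherwise
it would miss a point of the arc, and an arc joining the ends around that point would close up to
a simple closed curve. -/
theorem IsDendrite.image_subset_of_isPreconnected {X : Type*} [MetricSpace X] (hX : IsDendrite X)
    {α : ℝ → X} (hα : ContinuousOn α (Icc 0 1)) (hαi : InjOn α (Icc 0 1)) {S : Set X}
    (hS : IsPreconnected S) (h0 : α 0 ∈ S) (h1 : α 1 ∈ S) : α '' Icc 0 1 ⊆ S := by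
  have := hX.compactSpace
  have := hX.locallyConnectedSpace
  rintro _ ⟨t, ht, rfl⟩
  by_contra hc
  have hSc : S ⊆ {α t}ᶜ := fun x hx hxt => hc (by rwa [← mem_singleton_iff.1 hxt])
  have hSU := hS.subset_connectedComponentIn h0 hSc
  have h01 : α 0 ≠ α 1 := fun h => zero_ne_one (hαi (by simp) (by simp) h)
  obtain ⟨β, hβ, hβi, hβ0, hβ1, hβU⟩ :=
    (isOpen_compl_singleton.connectedComponentIn (x := α 0)).exists_injOn_path
    isPreconnected_connectedComponentIn (hSU h0) (hSU h1) h01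
  have hβt : ∀ s ∈ Icc (0 : ℝ) 1, β s ≠ α t := fun s hs =>
    connectedComponentIn_subset _ _ (hβU ⟨s, hs, rfl⟩)
  have hcl : ∀ u ∈ Icc (0 : ℝ) 1, ∀ v ∈ Icc (0 : ℝ) 1, IsClosed (α '' Icc u v) := fun u hu v hv =>
    (isCompact_Icc.image_of_continuousOn (hα.mono (Icc_subset_Icc hu.1 hv.2))).isClosed
  have hI0 : (0 : ℝ) ∈ Icc (0 : ℝ) 1 := by simp
  have hI1 : (1 : ℝ) ∈ Icc (0 : ℝ) 1 := by simp
  -- `β` reaches the part of the arc after `α t` for the first time at `s₂`,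
  -- and `s₁` is the last time before when it is in the part before `α t`.
  obtain ⟨s₂, ⟨hs₂, u₂, hu₂, hβs₂⟩, hmin⟩ :=
    (isCompact_Icc.of_isClosed_subset (hβ.preimage_isClosed_of_isClosed isClosed_Icc
      (hcl t ht 1 hI1)) inter_subset_left).exists_isLeast ⟨1, hI1, 1, ⟨ht.2, le_rfl⟩, hβ1.symm⟩
  have hs₂I : Icc 0 s₂ ⊆ Icc (0 : ℝ) 1 := Icc_subset_Icc le_rfl hs₂.2
  obtain ⟨s₁, ⟨hs₁, u₁, hu₁, hβs₁⟩, hmax⟩ :=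
    (isCompact_Icc.of_isClosed_subset ((hβ.mono hs₂I).preimage_isClosed_of_isClosed isClosed_Icc
      (hcl 0 hI0 t ht)) inter_subset_left).exists_isGreatest
        ⟨0, ⟨le_rfl, hs₂.1⟩, 0, ⟨le_rfl, ht.1⟩, hβ0.symm⟩
  have hu₁t : u₁ < t := hu₁.2.lt_of_ne fun h => hβt s₁ (hs₂I hs₁) (by rw [← hβs₁, h])
  have hu₂t : t < u₂ := hu₂.1.lt_of_ne fun h => hβt s₂ hs₂ (by rw [← hβs₂, h])
  have hss : s₁ < s₂ := hs₁.2.lt_of_ne fun h => by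
    rw [h, ← hβs₂] at hβs₁
    have := hαi ⟨hu₁.1, hu₁.2.trans ht.2⟩ ⟨ht.1.trans hu₂.1, hu₂.2⟩ hβs₁
    linarith
  have hmapα : MapsTo (fun r : ℝ => u₁ + r * (u₂ - u₁)) (Icc 0 1) (Icc 0 1) := fun r hr =>
    ⟨by nlinarith [hr.1, hu₁.1], by nlinarith [hr.2, hu₂.2]⟩
  have hmapβ : MapsTo (fun r : ℝ => s₁ + r * (s₂ - s₁)) (Icc 0 1) (Icc 0 1) := fun r hr =>
    ⟨by nlinarith [hr.1, hs₁.1], by nlinarith [hr.2, hs₂.2]⟩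
  obtain ⟨C, hC⟩ := exists_isSimpleClosedCurve
    (α := fun r => α (u₁ + r * (u₂ - u₁))) (β := fun r => β (s₁ + r * (s₂ - s₁)))
    (hα.comp (by fun_prop) hmapα) (hβ.comp (by fun_prop) hmapβ)
    (hαi.comp (fun r _ r' _ h => by
      have h' : r * (u₂ - u₁) = r' * (u₂ - u₁) := add_left_cancel h
      exact mul_right_cancel₀ (by linarith) h') hmapα)
    (hβi.comp (fun r _ r' _ h => by
      have h' : r * (s₂ - s₁) = r' * (s₂ - s₁) := add_left_cancel h
      exact mul_right_cancel₀ (by linarith) h') hmapβ)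
    (by simpa using hβs₁) (by simpa using hβs₂)
    (fun r hr r' hr' h => by
      have hrI := hmapα hr
      have hr'I := hmapβ (Ioo_subset_Icc_self hr')
      have hlt : s₁ + r' * (s₂ - s₁) < s₂ := by nlinarith [hr'.2]
      have hgt : s₁ < s₁ + r' * (s₂ - s₁) := by nlinarith [hr'.1]
      rcases le_total (u₁ + r * (u₂ - u₁)) t with h' | h'
      · exact not_lt.2 (hmax ⟨⟨hr'I.1, hlt.le⟩, _, ⟨hrI.1, h'⟩, h⟩) hgt
      · exact not_lt.2 (hmin ⟨hr'I, _, ⟨h', hrI.2⟩, h⟩) hlt)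
  exact hX.not_isSimpleClosedCurve C hC

/-- The segment between two points: the points that lie in every connected set containing both.
In a dendrite this is the unique arc joining them. -/
def seg {X : Type*} [TopologicalSpace X] (a b : X) : Set X :=
  {x | ∀ S : Set X, IsPreconnected S → a ∈ S → b ∈ S → x ∈ S}

section seg
variable {X : Type*} [TopologicalSpace X] {a b c : X}

theorem left_mem_seg : a ∈ seg a b := fun _ _ h _ => h

theorem right_mem_seg : b ∈ seg a b := fun _ _ _ h => h

theorem seg_comm (a b : X) : seg a b = seg b a := by
  ext x
  exact ⟨fun h S hS ha hb => h S hS hb ha, fun h S hS ha hb => h S hS hb ha⟩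

theorem seg_self (a : X) : seg a a = {a} := by
  ext x
  refine ⟨fun h => h {a} isPreconnected_singleton rfl rfl, ?_⟩
  rintro rfl
  exact left_mem_seg

theorem seg_subset {S : Set X} (hS : IsPreconnected S) (ha : a ∈ S) (hb : b ∈ S) : seg a b ⊆ S :=
  fun _ hx => hx S hS ha hb

end seg

namespace IsDendrite
variable {X : Type*} [MetricSpace X] (hX : IsDendrite X)
include hX

/-- The segment between two distinct points of a dendrite is the image of an injective path. -/
theorem exists_param {a b : X} (hab : a ≠ b) :
    ∃ α : ℝ → X, ContinuousOn α (Icc 0 1) ∧ InjOn α (Icc 0 1) ∧ α 0 = a ∧ α 1 = b ∧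
      α '' Icc 0 1 = seg a b := by
  have := hX.compactSpace
  have := hX.connectedSpace
  have := hX.locallyConnectedSpace
  obtain ⟨α, hα, hαi, rfl, rfl, -⟩ :=
    isOpen_univ.exists_injOn_path isPreconnected_univ (mem_univ a) (mem_univ b) hab
  refine ⟨α, hα, hαi, rfl, rfl, Subset.antisymm ?_ ?_⟩
  · exact fun x hx S hS h0 h1 => hX.image_subset_of_isPreconnected hα hαi hS h0 h1 hx
  · exact seg_subset (isPreconnected_Icc.image _ hα) ⟨0, by simp, rfl⟩ ⟨1, by simp, rfl⟩

end IsDendrite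

namespace IsDendrite
variable {X : Type*} [MetricSpace X] (hX : IsDendrite X) {a b c p x y z : X}
include hX

theorem isArc_seg (hab : a ≠ b) : IsArc (seg a b) := by
  obtain ⟨α, hα, hαi, -, -, hs⟩ := hX.exists_param hab
  let F : unitInterval → X := fun t => α t
  have hF : Continuous F := continuousOn_iff_continuous_domRestrict.1 hα
  have hFi : Function.Injective F := fun s t h => Subtype.ext (hαi s.2 t.2 h)
  have hr : range F = seg a b := by
    rw [← hs]
    ext x
    simp [F]
  rw [← hr]
  exact ⟨(hF.isClosedEmbedding hFi).isEmbedding.toHomeomorph.symm⟩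

theorem isPreconnected_seg (a b : X) : IsPreconnected (seg a b) := by
  rcases eq_or_ne a b with rfl | hab
  · rw [seg_self]
    exact isPreconnected_singleton
  · obtain ⟨α, hα, -, -, -, hs⟩ := hX.exists_param hab
    rw [← hs]
    exact isPreconnected_Icc.image _ hα

theorem isCompact_seg (a b : X) : IsCompact (seg a b) := by
  rcases eq_or_ne a b with rfl | hab
  · rw [seg_self]
    exact isCompact_singleton
  · obtain ⟨α, hα, -, -, -, hs⟩ := hX.exists_param hab
    rw [← hs]
    exact isCompact_Icc.image_of_continuousOn hα

theorem isClosed_seg (a b : X) : IsClosed (seg a b) := (hX.isCompact_seg a b).isClosed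

theorem infinite_seg (hab : a ≠ b) : (seg a b).Infinite := by
  obtain ⟨α, hα, hαi, -, -, hs⟩ := hX.exists_param hab
  rw [← hs]
  exact (Icc_infinite zero_lt_one).image hαi

theorem seg_subset_seg (hx : x ∈ seg a b) (hy : y ∈ seg a b) : seg x y ⊆ seg a b :=
  seg_subset (hX.isPreconnected_seg a b) hx hy

theorem seg_subset_union (a b c : X) : seg a b ⊆ seg a c ∪ seg c b :=
  seg_subset ((hX.isPreconnected_seg a c).union c right_mem_seg left_mem_seg
    (hX.isPreconnected_seg c b)) (Or.inl left_mem_seg) (Or.inr right_mem_seg)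

/-- A segment from `a` that stops before `b` on the way to `b` does not contain `b`. -/
theorem notMem_seg_of_mem_seg (hc : c ∈ seg a b) (hcb : c ≠ b) : b ∉ seg a c := by
  rcases eq_or_ne a b with rfl | hab
  · rw [seg_self] at hc
    exact absurd hc hcb
  obtain ⟨α, hα, hαi, rfl, rfl, hs⟩ := hX.exists_param hab
  rw [← hs] at hc
  obtain ⟨t, ht, rfl⟩ := hc
  intro h
  have hsub : Icc 0 t ⊆ Icc (0 : ℝ) 1 := Icc_subset_Icc le_rfl ht.2
  obtain ⟨s, hs, hs'⟩ := seg_subset (isPreconnected_Icc.image _ (hα.mono hsub))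
    ⟨0, ⟨le_rfl, ht.1⟩, rfl⟩ ⟨t, ⟨ht.1, le_rfl⟩, rfl⟩ h
  have := hαi (hsub hs) (by simp) hs'
  exact hcb (by rw [le_antisymm ht.2 (this ▸ hs.2)])

/-- For `x ∈ seg p y` with `x ≠ y`, the segments from `p` are strictly nested. -/
theorem seg_ssubset_seg (hx : x ∈ seg p y) (hxy : x ≠ y) : seg p x ⊂ seg p y :=
  ⟨hX.seg_subset_seg left_mem_seg hx,
    fun h => hX.notMem_seg_of_mem_seg hx hxy (h right_mem_seg)⟩

theorem eventually_notMem_seg (hzx : z ≠ x) : ∀ᶠ w in 𝓝 z, x ∉ seg z w := by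
  have := hX.locallyConnectedSpace
  have hz : z ∈ ({x}ᶜ : Set X) := hzx
  filter_upwards [(isOpen_compl_singleton.connectedComponentIn (x := z)).mem_nhds
    (mem_connectedComponentIn hz)] with w hw h
  exact connectedComponentIn_subset _ _ (seg_subset isPreconnected_connectedComponentIn
    (mem_connectedComponentIn hz) hw h) rfl

/-- The points beyond `c`, as seen from `p`, form a closed set. -/
theorem isClosed_setOf_mem_seg (p c : X) : IsClosed {z | c ∈ seg p z} := by
  rw [← isOpen_compl_iff, isOpen_iff_mem_nhds]
  intro z hz
  have hzc : z ≠ c := fun h => hz (h ▸ right_mem_seg)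
  filter_upwards [hX.eventually_notMem_seg hzc] with w hw hcw
  exact (hX.seg_subset_union p w z hcw).elim hz hw

/-- Short segments are small. -/
theorem eventually_seg_subset_nhds {U : Set X} (hU : U ∈ 𝓝 x) : ∀ᶠ w in 𝓝 x, seg x w ⊆ U := by
  have := hX.locallyConnectedSpace
  obtain ⟨V, ⟨hVo, hxV, hVc⟩, hVU⟩ :=
    (LocallyConnectedSpace.open_connected_basis x).mem_iff.1 hU
  filter_upwards [hVo.mem_nhds hxV] with w hw
  exact (seg_subset hVc.isPreconnected hxV hw).trans hVU

/-- If two segments from `r` meet only in `r`, then `r` is between their other ends. -/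
theorem mem_seg_of_inter (h : seg x r ∩ seg r y ⊆ {r}) : r ∈ seg x y := by
  by_contra hr
  have hdisj : seg x y ∩ (seg x r ∩ seg r y) = ∅ :=
    eq_empty_of_forall_notMem fun w hw => hr (by
      have := h hw.2
      rw [mem_singleton_iff] at this
      exact this ▸ hw.1)
  rcases (isPreconnected_iff_subset_of_disjoint_closed.1 (hX.isPreconnected_seg x y)) _ _
    (hX.isClosed_seg x r) (hX.isClosed_seg r y) (hX.seg_subset_union x y r) hdisj with h' | h'
  · exact hdisj.le ⟨right_mem_seg, h' right_mem_seg, right_mem_seg⟩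
  · exact hdisj.le ⟨left_mem_seg, left_mem_seg, h' left_mem_seg⟩

/-- The first point of a segment on the way from `z`. -/
theorem exists_seg_inter_eq (z a b : X) : ∃ r ∈ seg a b, seg z r ∩ seg a b ⊆ {r} := by
  rcases eq_or_ne z a with rfl | hza
  · exact ⟨z, left_mem_seg, by rw [seg_self]; exact inter_subset_left⟩
  obtain ⟨α, hα, hαi, h0, h1, hs⟩ := hX.exists_param hza
  obtain ⟨t, ⟨ht, htab⟩, hmin⟩ :=
    (isCompact_Icc.of_isClosed_subset (hα.preimage_isClosed_of_isClosed isClosed_Icc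
      (hX.isClosed_seg a b)) inter_subset_left).exists_isLeast
      ⟨1, by simp, by rw [mem_preimage, h1]; exact left_mem_seg⟩
  refine ⟨α t, htab, ?_⟩
  rintro w ⟨hw, hwab⟩
  have hsub : Icc 0 t ⊆ Icc (0 : ℝ) 1 := Icc_subset_Icc le_rfl ht.2
  obtain ⟨s, hs, rfl⟩ := seg_subset (isPreconnected_Icc.image _ (hα.mono hsub))
    ⟨0, ⟨le_rfl, ht.1⟩, h0⟩ ⟨t, ⟨ht.1, le_rfl⟩, rfl⟩ hw
  rw [le_antisymm hs.2 (hmin ⟨hsub hs, hwab⟩)]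
  rfl

/-- Any three points of a dendrite have a median, namely the first point of the segment between
two of them on the way from the third. -/
theorem exists_median (z a b : X) : ∃ r ∈ seg a b, r ∈ seg z a ∧ r ∈ seg z b ∧
    seg z r ∩ seg a b ⊆ {r} := by
  obtain ⟨r, hr, h⟩ := hX.exists_seg_inter_eq z a b
  refine ⟨r, hr, hX.mem_seg_of_inter fun w hw => h ⟨hw.1, ?_⟩,
    hX.mem_seg_of_inter fun w hw => h ⟨hw.1, ?_⟩, h⟩
  · exact hX.seg_subset_seg hr left_mem_seg hw.2
  · exact hX.seg_subset_seg hr right_mem_seg hw.2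

end IsDendrite

/-! ### Chains and neighbourhoods in finite trees -/

/-- The connected component of `x` in the complement of `m`; nothing if `x = m`. -/
noncomputable def componentAt {X : Type*} [TopologicalSpace X] (m x : X) :
    Option (ConnectedComponents ↥({m}ᶜ : Set X)) :=
  open Classical in if h : x ∈ ({m}ᶜ : Set X) then some (ConnectedComponents.mk ⟨x, h⟩) else none

theorem componentAt_eq_none {X : Type*} [TopologicalSpace X] {m x : X} :
    componentAt m x = none ↔ x = m := by
  simp [componentAt]

theorem componentAt_of_ne {X : Type*} [TopologicalSpace X] {m x : X} (h : x ≠ m) :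
    componentAt m x = some (ConnectedComponents.mk ⟨x, h⟩) :=
  dif_pos h

theorem componentAt_ne_of_mem_seg {X : Type*} [TopologicalSpace X] {m x y : X} (hx : x ≠ m)
    (hm : m ∈ seg x y) : componentAt m x ≠ componentAt m y := by
  intro h
  have hy : y ≠ m := fun hy => hx (componentAt_eq_none.1 (h.trans (componentAt_eq_none.2 hy)))
  rw [componentAt_of_ne hx, componentAt_of_ne hy, Option.some_inj,
    ConnectedComponents.coe_eq_coe] at h
  obtain ⟨w, -, hw⟩ := hm _ ((isPreconnected_connectedComponent
    (x := (⟨x, hx⟩ : ({m}ᶜ : Set X)))).image _ continuous_subtype_val.continuousOn)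
    ⟨_, mem_connectedComponent, rfl⟩ ⟨⟨y, hy⟩, h ▸ mem_connectedComponent, rfl⟩
  exact w.2 hw

/-- A point that separates three points from one another is a branching point. -/
theorem IsBranchingPoint.of_mem_seg {X : Type*} [TopologicalSpace X] {m x y z : X} (hx : x ≠ m)
    (hy : y ≠ m) (hz : z ≠ m) (hxy : m ∈ seg x y) (hxz : m ∈ seg x z) (hyz : m ∈ seg y z) :
    IsBranchingPoint m := by
  have h1 := componentAt_ne_of_mem_seg hx hxy
  have h2 := componentAt_ne_of_mem_seg hx hxz
  have h3 := componentAt_ne_of_mem_seg hy hyz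
  rw [componentAt_of_ne hx, componentAt_of_ne hy, Ne, Option.some_inj] at h1
  rw [componentAt_of_ne hx, componentAt_of_ne hz, Ne, Option.some_inj] at h2
  rw [componentAt_of_ne hy, componentAt_of_ne hz, Ne, Option.some_inj] at h3
  rw [IsBranchingPoint, pointOrder, ← encard_univ,
    ← encard_eq_three.2 ⟨_, _, _, h1, h2, h3, rfl⟩]
  exact encard_le_encard (subset_univ _)

namespace IsFiniteTree
variable {X : Type*} [MetricSpace X] (hX : IsFiniteTree X) {a b j : X}
include hX

theorem finite_connectedComponents (m : X) : Finite (ConnectedComponents ↥({m}ᶜ : Set X)) := by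
  rw [← ENat.card_lt_top]
  by_cases h : IsBranchingPoint m
  · exact hX.pointOrder_lt_top m h
  · exact (not_le.1 h).trans (ENat.natCast_lt_top 3)

/-- For every root `p`, a finite tree is a finite union of chains of the order in which `x` is
below `y` when `x ∈ seg p y`: points in the same components of the complements of `p` and of all
branching points are comparable. -/
theorem exists_chain_labelling (p : X) : ∃ (L : Type) (_ : Finite L) (l : X → L),
    ∀ x y, l x = l y → x ∈ seg p y ∨ y ∈ seg p x := by
  let B : Set X := insert p {x | IsBranchingPoint x}
  have : Finite B := (hX.finite_branchingPoints.insert p).to_subtype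
  have := hX.finite_connectedComponents
  obtain ⟨n, ⟨e⟩⟩ := Finite.exists_equiv_fin
    (∀ b : B, Option (ConnectedComponents ↥({(b : X)}ᶜ : Set X)))
  refine ⟨Fin n, inferInstance, fun x => e fun b => componentAt (b : X) x, fun x y hxy => ?_⟩
  have hxy' := congr_fun (e.injective hxy)
  obtain ⟨m, hmx, hmy, hm, -⟩ := hX.toIsDendrite.exists_median y p x
  rw [seg_comm y p] at hmy
  rw [seg_comm y x] at hm
  by_cases h1 : x = m
  · exact Or.inl (h1 ▸ hmy)
  by_cases h2 : y = m
  · exact Or.inr (h2 ▸ hmx)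
  refine absurd (hxy' ⟨m, ?_⟩) (componentAt_ne_of_mem_seg h1 hm)
  by_cases h3 : p = m
  · exact Or.inl h3.symm
  · exact Or.inr (.of_mem_seg h3 h1 h2 hmx hmy hm)

/-- Away from its ends and the branching points, a segment in a finite tree is a neighbourhood of
each of its points. -/
theorem seg_mem_nhds (hj : j ∈ seg a b) (hja : j ≠ a) (hjb : j ≠ b) (hjB : ¬ IsBranchingPoint j) :
    seg a b ∈ 𝓝 j := by
  have hB : (insert a (insert b {x | IsBranchingPoint x}))ᶜ ∈ 𝓝 j := by
    refine (((hX.finite_branchingPoints.insert b).insert a).isClosed.isOpen_compl).mem_nhds ?_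
    simp [hja, hjb, hjB]
  filter_upwards [hX.toIsDendrite.eventually_seg_subset_nhds hB] with z hz
  obtain ⟨r, hr, hra, hrb, h⟩ := hX.toIsDendrite.exists_median z a b
  -- The first point `r` of the segment on the way from `z` is on the way to `j`.
  have hrj : r ∈ seg j z := by
    rw [seg_comm]
    exact hX.toIsDendrite.mem_seg_of_inter fun w hw =>
      h ⟨hw.1, hX.toIsDendrite.seg_subset_seg hr hj hw.2⟩
  have hr' := hz hrj
  simp only [mem_compl_iff, mem_insert_iff, mem_ofPred_eq, not_or] at hr'
  by_cases hzr : z = r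
  · exact hzr ▸ hr
  · exact absurd (.of_mem_seg hzr (Ne.symm hr'.1) (Ne.symm hr'.2.1) hra hrb hr) hr'.2.2

end IsFiniteTree

/-! ### Fixed points and backward orbits -/

namespace IsDendrite
variable {X : Type*} [MetricSpace X] (hX : IsDendrite X) {f : X → X} {a b m p x y z : X}
include hX

/-- Antisymmetry of the order with root `p`. -/
theorem eq_of_mem_seg_of_mem_seg (hx : x ∈ seg p y) (hy : y ∈ seg p x) : x = y := by
  by_contra h
  exact hX.notMem_seg_of_mem_seg hx h hy

theorem mem_seg_trans (hx : x ∈ seg p y) (hy : y ∈ seg p z) : x ∈ seg p z :=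
  hX.seg_subset_seg left_mem_seg hy hx

/-- Moving on from `m` towards `b`, one stays beyond `m` as seen from `a`. -/
theorem mem_seg_of_mem_right (hm : m ∈ seg a b) (hz : z ∈ seg m b) : m ∈ seg a z := by
  rcases hX.seg_subset_union a b z hm with h | h
  · exact h
  · rw [seg_comm] at h hz
    rw [hX.eq_of_mem_seg_of_mem_seg h hz]
    exact right_mem_seg

/-- If `x` is below `y` and `y` below `z`, then `y` is between `x` and `z`. -/
theorem mem_seg_of_mem_left (hx : x ∈ seg p y) (hy : y ∈ seg p z) : y ∈ seg x z := by
  rcases hX.seg_subset_union p z x hy with h | h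
  · rw [hX.eq_of_mem_seg_of_mem_seg h hx]
    exact left_mem_seg
  · exact h

/-- The fixed point theorem for dendrites. Order the dendrite from a root `p`; a maximal `m` with
`m ∈ seg p (f m)` is fixed, because otherwise points slightly beyond `m` on the way to `f m` have
the same property. -/
theorem exists_fixedPoint (hf : Continuous f) : ∃ p, f p = p := by
  have := hX.compactSpace
  obtain ⟨p⟩ := hX.connectedSpace.toNonempty
  let S : Set X := {x | x ∈ seg p (f x)}
  have hp : p ∈ S := left_mem_seg
  have hchain : ∀ c : Set S, IsChain (fun x y : S => (x : X) ∈ seg p y) c →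
      ∃ ub : S, ∀ x ∈ c, (x : X) ∈ seg p ub := by
    intro c hc
    rcases c.eq_empty_or_nonempty with rfl | hne
    · exact ⟨⟨p, hp⟩, by simp⟩
    have : Nonempty c := hne.to_subtype
    let t : c → Set X := fun x => closure {y | ∃ h : y ∈ S, ⟨y, h⟩ ∈ c ∧ ((x : S) : X) ∈ seg p y}
    have ht : ∀ x y : c, ((x : S) : X) ∈ seg p y → t y ⊆ t x := fun x y hxy =>
      closure_mono fun z ⟨h, hz, hyz⟩ => ⟨h, hz, hX.mem_seg_trans hxy hyz⟩
    have hdir : Directed (· ⊇ ·) t := fun x y => by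
      rcases eq_or_ne (x : S) y with h | h
      · exact ⟨x, Subset.rfl, by rw [Subtype.ext h]⟩
      · rcases hc x.2 y.2 h with h | h
        · exact ⟨y, ht x y h, Subset.rfl⟩
        · exact ⟨x, Subset.rfl, ht y x h⟩
    obtain ⟨z, hz⟩ := IsCompact.nonempty_iInter_of_directed_nonempty_isCompact_isClosed t hdir
      (fun x => ⟨x, subset_closure ⟨x.1.2, x.2, right_mem_seg⟩⟩)
      (fun x => isClosed_closure.isCompact) (fun x => isClosed_closure)
    rw [mem_iInter] at hz
    -- `z` is a limit of elements of the chain beyond `x`, for every `x` in the chain.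
    have h1 : ∀ x : c, ((x : S) : X) ∈ seg p z := fun x =>
      closure_minimal (t := {y | ((x : S) : X) ∈ seg p y})
        (by rintro y ⟨_, _, h⟩; exact h)
        (hX.isClosed_setOf_mem_seg p x) (hz x)
    have h2 : ∀ x : c, ((x : S) : X) ∈ seg p (f z) := fun x =>
      closure_minimal (t := f ⁻¹' {y | ((x : S) : X) ∈ seg p y})
        (by rintro y ⟨hy, _, h⟩; exact hX.mem_seg_trans h hy)
        ((hX.isClosed_setOf_mem_seg p x).preimage hf) (hz x)
    have hzS : z ∈ S := closure_minimal (t := seg p (f z))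
      (by rintro y ⟨hy, hyc, _⟩; exact h2 ⟨⟨y, hy⟩, hyc⟩) (hX.isClosed_seg p (f z))
      (hz (Classical.arbitrary c))
    exact ⟨⟨z, hzS⟩, fun x hx => h1 ⟨x, hx⟩⟩
  obtain ⟨⟨m, hm⟩, hmax⟩ := exists_maximal_of_chains_bounded hchain
    (fun {x y z} h h' => hX.mem_seg_trans h h')
  refine ⟨m, by_contra fun hne => ?_⟩
  have hne' : m ≠ f m := fun h => hne h.symm
  obtain ⟨k, hk, hk'⟩ := ((hX.infinite_seg hne').sdiff ((finite_singleton (f m)).insert m)).nonempty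
  simp only [mem_insert_iff, mem_singleton_iff, not_or] at hk'
  have hkf : k ∈ seg p (f m) := hX.seg_subset_seg hm right_mem_seg hk
  have hmk : m ∈ seg p k := hX.mem_seg_of_mem_right hm hk
  -- Points `z` close to `m` are mapped beyond `k`.
  have hev : ∀ᶠ z in 𝓝 m, k ∈ seg p (f z) := by
    filter_upwards [hf.continuousAt.eventually
      (hX.eventually_notMem_seg (Ne.symm hk'.2))] with z hz
    rcases hX.seg_subset_union p (f m) (f z) hkf with h | h
    · exact h
    · rw [seg_comm] at h
      exact absurd h hz
  have hacc := (hX.isPreconnected_seg m k).preperfect_of_nontrivial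
    ⟨m, left_mem_seg, k, right_mem_seg, Ne.symm hk'.1⟩ m left_mem_seg
  obtain ⟨z, ⟨hzm, hz⟩, hkz⟩ := ((accPt_iff_frequently.1 hacc).and_eventually hev).exists
  have hzk : z ∈ seg p k := hX.seg_subset_seg hmk right_mem_seg hz
  exact hzm (hX.eq_of_mem_seg_of_mem_seg (hmax ⟨z, hX.mem_seg_trans hzk hkz⟩
    (hX.mem_seg_of_mem_right hmk hz)) (hX.mem_seg_of_mem_right hmk hz))

theorem seg_subset_image (hf : Continuous f) (a b : X) : seg (f a) (f b) ⊆ f '' seg a b :=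
  seg_subset ((hX.isPreconnected_seg a b).image f hf.continuousOn) ⟨a, left_mem_seg, rfl⟩
    ⟨b, right_mem_seg, rfl⟩

theorem not_seg_ssubset_seg (hf : Continuous f) (hno : ∀ A, ¬ IsExpandingArc f A) {n : ℕ}
    (hn : 1 ≤ n) (hab : a ≠ b) : ¬ seg a b ⊂ seg (f^[n] a) (f^[n] b) := fun h =>
  hno _ ⟨hX.isArc_seg hab, n, hn, h.trans_subset (hX.seg_subset_image (hf.iterate n) a b)⟩

/-- Without expanding arcs, no iterate of a point is strictly farther away from a fixed point. -/
theorem eq_iterate_of_mem_seg (hf : Continuous f) (hno : ∀ A, ¬ IsExpandingArc f A)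
    (hp : f p = p) {n : ℕ} (h : x ∈ seg p (f^[n] x)) : f^[n] x = x := by
  by_contra hne
  have hpn : f^[n] p = p := Function.iterate_fixed hp n
  have hn : 1 ≤ n := Nat.one_le_iff_ne_zero.2 (by rintro rfl; exact hne rfl)
  have hpx : p ≠ x := by
    rintro rfl
    exact hne hpn
  refine hX.not_seg_ssubset_seg hf hno hn hpx ?_
  rw [hpn]
  exact hX.seg_ssubset_seg h (Ne.symm hne)

end IsDendrite

/-- The points with arbitrarily long backward orbits. -/
def iInterRange {X : Type*} (f : X → X) : Set X := ⋂ n : ℕ, range f^[n]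

theorem mem_iInterRange {X : Type*} {f : X → X} {x : X} :
    x ∈ iInterRange f ↔ ∀ n, x ∈ range f^[n] := mem_iInter

theorem range_iterate_antitone {X : Type*} (f : X → X) : Antitone fun n : ℕ => range f^[n] := by
  intro m n hmn
  dsimp only
  rw [← Nat.add_sub_cancel' hmn, Function.iterate_add]
  exact range_comp_subset_range _ _

theorem isClosed_range_iterate {X : Type*} [MetricSpace X] [CompactSpace X] {f : X → X}
    (hf : Continuous f) (n : ℕ) : IsClosed (range f^[n]) :=
  (isCompact_range (hf.iterate n)).isClosed

theorem exists_mem_iInterRange_apply_eq {X : Type*} [MetricSpace X] [CompactSpace X] {f : X → X}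
    (hf : Continuous f) {x : X} (hx : x ∈ iInterRange f) : ∃ y ∈ iInterRange f, f y = x := by
  obtain ⟨y, hy⟩ := IsCompact.nonempty_iInter_of_sequence_nonempty_isCompact_isClosed
    (fun n => range f^[n] ∩ f ⁻¹' {x})
    (fun n => inter_subset_inter_left _ (range_iterate_antitone f n.le_succ))
    (fun n => by
      obtain ⟨z, hz⟩ := mem_iInterRange.1 hx (n + 1)
      rw [Function.iterate_succ_apply'] at hz
      exact ⟨f^[n] z, ⟨z, rfl⟩, hz⟩)
    ((isClosed_range_iterate hf 0).inter (isClosed_singleton.preimage hf)).isCompact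
    (fun n => (isClosed_range_iterate hf n).inter (isClosed_singleton.preimage hf))
  rw [mem_iInter] at hy
  exact ⟨y, mem_iInterRange.2 fun n => (hy n).1, (hy 0).2⟩

theorem exists_backward_orbit {X : Type*} [MetricSpace X] [CompactSpace X] {f : X → X}
    (hf : Continuous f) {x : X} (hx : x ∈ iInterRange f) :
    ∃ u : ℕ → X, u 0 = x ∧ ∀ j, f (u (j + 1)) = u j := by
  choose g hg hg' using fun y : iInterRange f => exists_mem_iInterRange_apply_eq hf y.2
  let G : iInterRange f → iInterRange f := fun y => ⟨g y, hg y⟩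
  refine ⟨fun n => (G^[n] ⟨x, hx⟩).1, rfl, fun j => ?_⟩
  simp only [Function.iterate_succ_apply']
  exact hg' _

/-- A function into a finite type is constant along an ultrafilter. -/
theorem Ultrafilter.exists_eventually_eq {α L : Type*} [Finite L] (U : Ultrafilter α) (l : α → L) :
    ∃ c, ∀ᶠ i in U, l i = c := by
  obtain ⟨c, -, hc⟩ := Ultrafilter.eq_pure_of_finite_mem (f := U.map l) (finite_univ) univ_mem
  refine ⟨c, ?_⟩
  have : {c} ∈ U.map l := by rw [hc]; exact mem_pure.2 rfl
  exact this

namespace IsFiniteTree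
variable {X : Type*} [MetricSpace X] (hX : IsFiniteTree X) {f : X → X}
include hX

/-- Without expanding arcs, every point with an infinite backward orbit is periodic. If it is not,
the backward orbit is strictly increasing on each of the finitely many chains given by
`exists_chain_labelling`. So it has only finitely many cluster points; one of them, `y`, is
periodic, and the segment from a point of the orbit to `y` expands. -/
theorem mem_periodicPts_of_backward_orbit (hf : Continuous f)
    (hno : ∀ A, ¬ IsExpandingArc f A) {x : ℕ → X} (hx : ∀ j, f (x (j + 1)) = x j) :
    x 0 ∈ Function.periodicPts f := by
  by_contra hnp
  have hD := hX.toIsDendrite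
  have := hD.compactSpace
  obtain ⟨p, hp⟩ := hD.exists_fixedPoint hf
  obtain ⟨L, hL, l, hl⟩ := hX.exists_chain_labelling p
  have hit : ∀ m j, f^[m] (x (j + m)) = x j := by
    intro m
    induction m with
    | zero => intro j; rfl
    | succ m ih => intro j; rw [Function.iterate_succ_apply, ← add_assoc, hx, ih]
  have hnper : ∀ j, x j ∉ Function.periodicPts f := by
    rintro j ⟨n, hn, h⟩
    refine hnp ⟨n, hn, ?_⟩
    have := h.apply_iterate j
    have e := hit j 0
    rw [zero_add] at e
    rwa [e] at this
  have hinj : ∀ i j, i < j → x i ≠ x j := by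
    intro i j hij h
    have e := hit (j - i) i
    rw [Nat.add_sub_cancel' hij.le, h] at e
    exact hnper j ⟨j - i, by omega, e⟩
  have hmono : ∀ i j, i < j → l (x i) = l (x j) → x i ∈ seg p (x j) := by
    intro i j hij h
    refine (hl _ _ h).resolve_right fun h' => ?_
    have e := hit (j - i) i
    rw [Nat.add_sub_cancel' hij.le] at e
    rw [← e] at h'
    exact hinj i j hij (e.symm.trans (hD.eq_iterate_of_mem_seg hf hno hp h'))
  -- `R y c`: the part of the backward orbit in the chain labelled `c` has the cluster point `y`.
  let R : X → L → Prop := fun y c => ∃ U : Ultrafilter ℕ, (U : Filter ℕ) ≤ atTop ∧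
    Tendsto x U (𝓝 y) ∧ ∀ᶠ j in U, l (x j) = c
  have hRle : ∀ y c, R y c → ∀ i, l (x i) = c → x i ∈ seg p y := by
    rintro y c ⟨U, hU, hUy, hUc⟩ i hi
    refine (hD.isClosed_setOf_mem_seg p (x i)).mem_of_tendsto hUy ?_
    filter_upwards [hUc, hU (eventually_gt_atTop i)] with j hj hij
    exact hmono i j hij (hi.trans hj.symm)
  have hRle' : ∀ y y' c, R y c → R y' c → y' ∈ seg p y := by
    rintro y y' c hy ⟨U, hU, hUy, hUc⟩
    exact (hD.isClosed_seg p y).mem_of_tendsto hUy (hUc.mono fun i hi => hRle y c hy i hi)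
  let A : Set X := {y | ∃ c, R y c}
  have hAfin : A.Finite := by
    choose lab hlab using fun y : A => y.2
    have : Function.Injective lab := fun y y' h => Subtype.ext
      (hD.eq_of_mem_seg_of_mem_seg (hRle' y' y _ (h ▸ hlab y') (hlab y))
        (hRle' y y' _ (hlab y) (h ▸ hlab y')))
    exact Set.finite_coe_iff.1 (Finite.of_injective lab this)
  have hAf : ∀ y ∈ A, f y ∈ A := by
    rintro y ⟨c, U, hU, hUy, -⟩
    have hsub : Tendsto x (U.map (· - 1)) (𝓝 (f y)) := by
      rw [Ultrafilter.coe_map, tendsto_map'_iff]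
      refine (((hf.tendsto y).comp hUy)).congr' ?_
      filter_upwards [hU (eventually_ge_atTop 1)] with j hj
      obtain ⟨i, rfl⟩ := Nat.exists_eq_add_of_le' hj
      simp [hx]
    obtain ⟨c', hc'⟩ := (U.map (· - 1)).exists_eventually_eq fun j => l (x j)
    exact ⟨c', U.map (· - 1), (tendsto_sub_atTop_nat 1).mono_left hU, hsub, hc'⟩
  obtain ⟨y₀, hy₀⟩ : A.Nonempty := by
    let U := hyperfilter ℕ
    obtain ⟨y, -, hy⟩ := isCompact_univ.ultrafilter_le_nhds (U.map x) (by simp)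
    obtain ⟨c, hc⟩ := U.exists_eventually_eq fun j => l (x j)
    exact ⟨y, c, U, Nat.hyperfilter_le_atTop, hy, hc⟩
  obtain ⟨y, ⟨c, U, hU, hUy, hUc⟩, N, hN, hyN⟩ : ∃ y ∈ A, y ∈ Function.periodicPts f := by
    have hA : ∀ n, f^[n] y₀ ∈ A := fun n => by
      induction n with
      | zero => exact hy₀
      | succ n ih => rw [Function.iterate_succ_apply']; exact hAf _ ih
    have := hAfin.to_subtype
    obtain ⟨i, j, hij, he⟩ :=
      Finite.exists_ne_map_eq_of_infinite fun n : ℕ => (⟨f^[n] y₀, hA n⟩ : A)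
    have he' : f^[i] y₀ = f^[j] y₀ := congrArg Subtype.val he
    rcases lt_or_gt_of_ne hij with h | h
    · refine ⟨f^[i] y₀, hA i, j - i, by omega, ?_⟩
      rw [Function.IsPeriodicPt, Function.IsFixedPt, ← Function.iterate_add_apply,
        Nat.sub_add_cancel h.le, he']
    · refine ⟨f^[j] y₀, hA j, i - j, by omega, ?_⟩
      rw [Function.IsPeriodicPt, Function.IsFixedPt, ← Function.iterate_add_apply,
        Nat.sub_add_cancel h.le, he']
  -- Two indices `i < j` in the chain of `y` that are congruent modulo the period `N` of `y`.
  obtain ⟨r, hr⟩ := U.exists_eventually_eq fun j => (⟨j % N, Nat.mod_lt j hN⟩ : Fin N)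
  obtain ⟨i, hic, hir⟩ := (hUc.and hr).exists
  obtain ⟨j, ⟨hjc, hjr⟩, hij⟩ := ((hUc.and hr).and (hU (eventually_gt_atTop i))).exists
  have hmod : N ∣ j - i :=
    (Nat.modEq_iff_dvd' hij.le).1 (Fin.mk_eq_mk.1 (hir.trans hjr.symm))
  have hy' : f^[j - i] y = y := hyN.trans_dvd hmod
  have hxy : ∀ k, l (x k) = c → x k ∈ seg p y := hRle y c ⟨U, hU, hUy, hUc⟩
  have hxj : f^[j - i] (x j) = x i := by
    have e := hit (j - i) i
    rwa [Nat.add_sub_cancel' hij.le] at e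
  have hjy : x j ≠ y := fun h => hnper j (h ▸ ⟨N, hN, hyN⟩)
  refine hD.not_seg_ssubset_seg hf hno (n := j - i) (by omega) hjy ?_
  rw [hxj, hy', seg_comm (x j), seg_comm (x i)]
  refine hD.seg_ssubset_seg ?_ (hinj i j hij).symm
  rw [seg_comm]
  exact hD.mem_seg_of_mem_left (hmono i j hij (hic.trans hjc.symm)) (hxy j hjc)

/-- Without expanding arcs, some iterate of `f` is the identity on `⋂ n, range f^[n]`: points of
one orbit that lie in the same chain coincide, so the periods are bounded. -/
theorem exists_iterate_eq_self (hf : Continuous f) (hno : ∀ A, ¬ IsExpandingArc f A) :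
    ∃ N, 1 ≤ N ∧ ∀ x ∈ iInterRange f, f^[N] x = x := by
  have hD := hX.toIsDendrite
  have := hD.compactSpace
  obtain ⟨p, hp⟩ := hD.exists_fixedPoint hf
  obtain ⟨L, hL, l, hl⟩ := hX.exists_chain_labelling p
  obtain ⟨K, ⟨e⟩⟩ := Finite.exists_equiv_fin L
  refine ⟨K.factorial, K.factorial_pos, fun x hx => ?_⟩
  obtain ⟨P, hP, hPx⟩ : x ∈ Function.periodicPts f := by
    obtain ⟨u, rfl, hu⟩ := exists_backward_orbit hf hx
    exact hX.mem_periodicPts_of_backward_orbit hf hno hu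
  obtain ⟨i, j, hij, hjK, hlij⟩ : ∃ i j : ℕ, i < j ∧ j ≤ K ∧ l (f^[i] x) = l (f^[j] x) := by
    obtain ⟨i, j, hij, h⟩ := Fintype.exists_ne_map_eq_of_card_lt
      (fun i : Fin (K + 1) => e (l (f^[i] x))) (by simp)
    have h' := e.injective h
    rcases lt_or_gt_of_ne hij with h'' | h''
    · exact ⟨i, j, h'', by omega, h'⟩
    · exact ⟨j, i, h'', by omega, h'.symm⟩
  -- The comparable points `u` and `f^[j - i] u` of a periodic orbit coincide.
  set u := f^[i] x with hu
  have hPu : Function.IsPeriodicPt f P u := hPx.apply_iterate i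
  have hju : f^[j] x = f^[j - i] u := by
    rw [hu, ← Function.iterate_add_apply, Nat.sub_add_cancel hij.le]
  have hper : f^[j - i] u = u := by
    rw [hju] at hlij
    rcases hl _ _ hlij with h | h
    · exact hD.eq_iterate_of_mem_seg hf hno hp h
    · have hret : f^[P * (j - i) - (j - i)] (f^[j - i] u) = u := by
        rw [← Function.iterate_add_apply, Nat.sub_add_cancel (Nat.le_mul_of_pos_left _ hP)]
        exact hPu.mul_const _
      have h' := hD.eq_iterate_of_mem_seg hf hno hp (x := f^[j - i] u)
        (n := P * (j - i) - (j - i)) (by rwa [hret])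
      rw [hret] at h'
      exact h'.symm
  have hKu : f^[K.factorial] u = u :=
    Function.IsPeriodicPt.trans_dvd (f := f) (m := j - i) hper
      (Nat.dvd_factorial (by omega) (by omega))
  have hux : f^[P * i - i] u = x := by
    rw [hu, ← Function.iterate_add_apply, Nat.sub_add_cancel (Nat.le_mul_of_pos_left _ hP)]
    exact hPx.mul_const i
  rw [← hux, ← Function.iterate_add_apply, Nat.add_comm, Function.iterate_add_apply, hKu]

end IsFiniteTree

/-! ### Equicontinuity -/

namespace IsFiniteTree
variable {X : Type*} [MetricSpace X] (hX : IsFiniteTree X)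
include hX

/-- A map of a finite tree that fixes every point of `⋂ n, range g^[n]` is equicontinuous.
Otherwise ever shorter segments `seg x (y k)` are mapped by high iterates onto sets that contain
a fixed segment in `⋂ n, range g^[n]`. An interior point `j` of it is then reached by points
`w k ∈ seg x (y k)` after many steps outside `⋂ n, range g^[n]`. The last positions before
reaching `j` accumulate at a preimage of `j` in `⋂ n, range g^[n]`, that is at `j` itself, which
is impossible since `⋂ n, range g^[n]` is a neighbourhood of `j`. -/
theorem equicontinuous_of_iInterRange_fixed {g : X → X} (hg : Continuous g)
    (hfix : ∀ x ∈ iInterRange g, g x = x) : Equicontinuous fun n : ℕ => g^[n] := by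
  have hD := hX.toIsDendrite
  have := hD.compactSpace
  have := hD.connectedSpace
  intro x
  rw [Metric.equicontinuousAt_iff]
  by_contra hcon
  push Not at hcon
  obtain ⟨ε, hε, hcon⟩ := hcon
  choose y hy n hn using fun k : ℕ => hcon (1 / ((k : ℝ) + 1)) (by positivity)
  have hyx : Tendsto y atTop (𝓝 x) := by
    rw [tendsto_iff_dist_tendsto_zero]
    exact squeeze_zero (fun _ => dist_nonneg) (fun k => (hy k).le)
      tendsto_one_div_add_atTop_nhds_zero_nat
  have hnt : ∀ M, ∀ᶠ k in atTop, M ≤ n k := by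
    intro M
    have : ∀ m ∈ Finset.range M, ∀ᶠ k in atTop, dist (g^[m] x) (g^[m] (y k)) < ε := by
      intro m _
      have h := (((hg.iterate m).tendsto x).comp hyx).dist
        (tendsto_const_nhds (x := g^[m] x))
      rw [dist_self] at h
      filter_upwards [h.eventually (gt_mem_nhds hε)] with k hk
      rwa [dist_comm]
    filter_upwards [(Finset.eventually_all (Finset.range M)).2 this] with k hk
    by_contra h
    exact not_lt.2 (hn k) (hk (n k) (Finset.mem_range.2 (not_le.1 h)))
  set T := iInterRange g with hT
  let U : Ultrafilter ℕ := hyperfilter ℕ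
  have hU : (U : Filter ℕ) ≤ atTop := Nat.hyperfilter_le_atTop
  have hlim : ∀ u : ℕ → X, ∃ a, Tendsto u U (𝓝 a) := fun u => by
    obtain ⟨a, -, ha⟩ := isCompact_univ.ultrafilter_le_nhds (U.map u) (by simp)
    exact ⟨a, ha⟩
  have hlimT : ∀ (u : ℕ → X) (a : X), Tendsto u U (𝓝 a) →
      (∀ M, ∀ᶠ k in U, u k ∈ range g^[M]) → a ∈ T := fun u a ha hu =>
    mem_iInterRange.2 fun M => (isClosed_range_iterate hg M).mem_of_tendsto ha (hu M)
  have hrange : ∀ (M m : ℕ) (z : X), M ≤ m → g^[m] z ∈ range g^[M] := fun M m z h =>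
    range_iterate_antitone g h ⟨z, rfl⟩
  obtain ⟨a, ha⟩ := hlim fun k => g^[n k] x
  obtain ⟨b, hb⟩ := hlim fun k => g^[n k] (y k)
  have haT : a ∈ T := hlimT _ a ha fun M =>
    ((hnt M).filter_mono hU).mono fun k hk => hrange M _ _ hk
  have hbT : b ∈ T := hlimT _ b hb fun M =>
    ((hnt M).filter_mono hU).mono fun k hk => hrange M _ _ hk
  have hab : a ≠ b := by
    rintro rfl
    have h := ge_of_tendsto' (ha.dist hb) hn
    rw [dist_self] at h
    exact not_lt.2 h hε
  have hsegT : seg a b ⊆ T := fun z hz => mem_iInterRange.2 fun M =>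
    seg_subset (isPreconnected_range (hg.iterate M)) (mem_iInterRange.1 haT M)
      (mem_iInterRange.1 hbT M) hz
  have hfixn : ∀ z ∈ T, ∀ m, g^[m] z = z := fun z hz m => Function.iterate_fixed (hfix z hz) m
  -- At most one point of `T` is in the orbit of `x`.
  have horb : {j | j ∈ T ∧ ∃ m, g^[m] x = j}.Finite := by
    refine Set.Subsingleton.finite ?_
    rintro _ ⟨h1, m, rfl⟩ _ ⟨h2, m', rfl⟩
    rw [← hfixn _ h1 m', ← hfixn _ h2 m, ← Function.iterate_add_apply,
      ← Function.iterate_add_apply, Nat.add_comm]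
  obtain ⟨j, hj, hj'⟩ := ((hD.infinite_seg hab).sdiff
    (((horb.union hX.finite_branchingPoints).insert b).insert a)).nonempty
  simp only [mem_insert_iff, mem_union, mem_ofPred_eq, not_or, not_and, not_exists] at hj'
  obtain ⟨hja, hjb, hjx, hjB⟩ := hj'
  have hjT : j ∈ T := hsegT hj
  have hjx : ∀ m, g^[m] x ≠ j := hjx hjT
  have hTj : T ∈ 𝓝 j := mem_of_superset (hX.seg_mem_nhds hj hja hjb hjB) hsegT
  have hw : ∀ᶠ k in U, ∃ w ∈ seg x (y k), g^[n k] w = j := by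
    filter_upwards [ha.eventually (hD.eventually_notMem_seg (Ne.symm hja)),
      hb.eventually (hD.eventually_notMem_seg (Ne.symm hjb))] with k hk hk'
    refine hD.seg_subset_image (hg.iterate (n k)) x (y k) ?_
    rcases hD.seg_subset_union a b (g^[n k] x) hj with h | h
    · exact absurd h hk
    rcases hD.seg_subset_union _ b (g^[n k] (y k)) h with h | h
    · exact h
    · rw [seg_comm] at h
      exact absurd h hk'
  -- `m` is the first time the orbit of `w` enters `T`, at `j`.
  have hwm : ∀ k, ∃ (w : X) (m : ℕ), (∃ w ∈ seg x (y k), g^[n k] w = j) →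
      w ∈ seg x (y k) ∧ g^[m] w = j ∧ ∀ i < m, g^[i] w ∉ T := by
    intro k
    by_cases h : ∃ w ∈ seg x (y k), g^[n k] w = j
    · obtain ⟨w, hw, hwj⟩ := h
      classical
      have hex : ∃ m, g^[m] w ∈ T := ⟨n k, hwj ▸ hjT⟩
      refine ⟨w, Nat.find hex, fun _ => ⟨hw, ?_, fun i hi => Nat.find_min hex hi⟩⟩
      have hle : Nat.find hex ≤ n k := Nat.find_min' hex (hwj ▸ hjT)
      rw [← hwj, ← Nat.sub_add_cancel hle, Function.iterate_add_apply,
        hfixn _ (Nat.find_spec hex)]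
    · exact ⟨x, 0, fun h' => absurd h' h⟩
  choose w m hwm using hwm
  have hwm' : ∀ᶠ k in U, w k ∈ seg x (y k) ∧ g^[m k] (w k) = j ∧ ∀ i < m k, g^[i] (w k) ∉ T :=
    hw.mono fun k hk => hwm k hk
  have hwx : Tendsto w U (𝓝 x) := by
    intro V hV
    rw [mem_map]
    filter_upwards [hwm', hU (hyx.eventually (hD.eventually_seg_subset_nhds hV))] with k hk hk'
    exact hk' hk.1
  have hmt : ∀ M, ∀ᶠ k in U, M ≤ m k := by
    intro M
    have : ∀ i ∈ Finset.range M, ∀ᶠ k in U, g^[i] (w k) ≠ j := fun i _ =>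
      (((hg.iterate i).tendsto x).comp hwx).eventually (isOpen_ne.mem_nhds (hjx i))
    filter_upwards [(Finset.eventually_all (Finset.range M)).2 this, hwm'] with k hk hk'
    by_contra h
    exact hk (m k) (Finset.mem_range.2 (not_le.1 h)) hk'.2.1
  obtain ⟨Z, hZ⟩ := hlim fun k => g^[m k - 1] (w k)
  have hZT : Z ∈ T := hlimT _ Z hZ fun M =>
    (hmt (M + 1)).mono fun k hk => hrange M _ _ (by omega)
  have hgZ : g Z = j := by
    refine tendsto_nhds_unique ((hg.tendsto Z).comp hZ) (tendsto_const_nhds.congr' ?_)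
    filter_upwards [hmt 1, hwm'] with k hk hk'
    rw [Function.comp_apply, ← Function.iterate_succ_apply' g, Nat.succ_eq_add_one,
      Nat.sub_add_cancel hk]
    exact hk'.2.1.symm
  have hZj : Z = j := (hfix Z hZT).symm.trans hgZ
  rw [hZj] at hZ
  obtain ⟨k, ⟨hk, hk'⟩, hk''⟩ := ((hZ.eventually hTj).and (hmt 1)).and hwm' |>.exists
  exact hk''.2.2 (m k - 1) (by omega) hk

end IsFiniteTree

/-- The iterates of `f` are equicontinuous as soon as those of one of its powers are. -/
theorem equicontinuous_iterate_of_pow {X : Type*} [MetricSpace X] [CompactSpace X] {f : X → X}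
    (hf : Continuous f) {N : ℕ} (hN : 1 ≤ N) (h : Equicontinuous fun n : ℕ => (f^[N])^[n]) :
    Equicontinuous fun n : ℕ => f^[n] := by
  intro x
  rw [Metric.equicontinuousAt_iff]
  intro ε hε
  have hu : UniformEquicontinuous fun r : Fin N => f^[r] :=
    uniformEquicontinuous_finite.2 fun r =>
      CompactSpace.uniformContinuous_of_continuous (hf.iterate r)
  obtain ⟨δ, hδ, hu⟩ := Metric.uniformEquicontinuous_iff.1 hu ε hε
  obtain ⟨η, hη, h⟩ := Metric.equicontinuousAt_iff.1 (h x) δ hδ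
  refine ⟨η, hη, fun y hy n => ?_⟩
  have := hu _ _ (h y hy (n / N)) ⟨n % N, Nat.mod_lt n hN⟩
  rwa [← Function.iterate_mul, ← Function.iterate_add_apply, ← Function.iterate_add_apply,
    Nat.mod_add_div] at this

theorem iInterRange_iterate_subset {X : Type*} (f : X → X) {N : ℕ} (hN : 1 ≤ N) :
    iInterRange f^[N] ⊆ iInterRange f := fun x hx => mem_iInterRange.2 fun n => by
  have := mem_iInterRange.1 hx n
  rw [← Function.iterate_mul] at this
  exact range_iterate_antitone f (Nat.le_mul_of_pos_left n hN) this

theorem mainTheorem3 {X : Type*} [MetricSpace X] (hX : IsFiniteTree X) (f : X → X)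
    (hf : Continuous f) (hne : ¬ IsEquicontinuousMap f) :
    ∃ A : Set X, IsExpandingArc f A := by
  by_contra! hno
  have := hX.compactSpace
  obtain ⟨N, hN, hfix⟩ := hX.exists_iterate_eq_self hf hno
  exact hne (equicontinuous_iterate_of_pow hf hN (hX.equicontinuous_of_iInterRange_fixed
    (hf.iterate N) fun x hx => hfix x (iInterRange_iterate_subset f hN hx)))
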